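/- Conventions. A discrete-cube morphism $\{0,1\}^m\to\{0,1\}^n$ is the restriction of an affine homomorphism $\mathbb{Z}^m\to\mathbb{Z}^n$. A cubespace is a set $X$ with sets $C^n(X)\subset X^{\{0,1\}^n}$ ($n\ge 0$), called the $n$-cubes, such that $q\circ\phi\in C^m(X)$ for every $q\in C^n(X)$ and every discrete-cube morphism $\phi:\{0,1\}^m\to\{0,1\}^n$, and such that $C^0(X)=X$. For $n\ge 1$, an $n$-corner is a map $q':\{0,1\}^n\setminus\{1^n\}\to X$ whose restriction to every $(n-1)$-face containing $0^n$ is in $C^{n-1}(X)$; a completion of it is an $n$-cube that extends it. A nilspace is a cubespace such that $C^1(X)=X^{\{0,1\}}$ and every $n$-corner, $n\ge1$, has a completion; it is a $k$-step nilspace if moreover every $(k+1)$-corner has a unique completion. For $i\ge 1$ write $x\sim_i y$ if there are $q_0,q_1\in C^{i+1}(X)$ with $q_0(0^{i+1})=x$, $q_1(0^{i+1})=y$ and $q_0(v)=q_1(v)$ for all $v\ne 0^{i+1}$. When $\sim_i$ is an equivalence relation, $\mathcal F_i(X)=X/{\sim_i}$ is the quotient cubespace, whose cubes are the images of the cubes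 of $X$. For an abelian group $Z$, the $n$-cubes of $\mathcal D_j(Z)$ are the elements of the subgroup of $Z^{\{0,1\}^n}$ generated by the maps that take a constant value $g\in Z$ on a face of codimension at most $j$ and the value $0$ off that face. A $Z$-bundle over a set $S$ is a set $B$ with a free action of $Z$ and a map $\pi:B\to S$ such that $s\mapsto\pi^{-1}(s)$ is a bijection from $S$ to the set of orbits of $Z$ in $B$. A $k$-fold abelian bundle structure on $X$ consists of sets $B_0,\dots,B_k=X$ with $B_0$ a singleton, abelian groups $Z_1,\dots,Z_k$, and for each $0\le i<k$ the structure of a $Z_{i+1}$-bundle $\pi_{i+1,i}:B_{i+1}\to B_i$; write $\pi_i:X\to B_i$ for the composition of the bundle maps. A cubespace $X$ with such a structure is a degree-$k$ bundle if, when each $B_i$ is equipped with the cubes $C^n(B_i)=\{\pi_i\circ q: q\in C^n(X)\}$, for every $0\le i<k$, every $n\ge0$ and every $q\in C^n(B_{i+1})$ we have $$\{q_2\in C^n(B_{i+1}):\pi_{i+1,i}\circ q=\pi_{i+1,i}\circ q_2\}=\{q+q_3: q_3\in C^n(\mathcal D_{i+1}(Z_{i+1}))\}.$$ Theorem. Let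 $k\ge 0$ and let $X$ be a non-empty cubespace. Then $X$ is a $k$-step nilspace if and only if $X$ admits a $k$-fold abelian bundle structure that makes it a degree-$k$ bundle. Moreover, for every such structure and every $i\in\{1,\dots,k\}$, the relation $\sim_i$ is an equivalence relation and $\mathcal F_i(X)=B_i$, in the sense that there is an isomorphism of cubespaces $\varphi:\mathcal F_i(X)\to B_i$ (a bijection that matches the cubes of every dimension) such that $\varphi([x])=\pi_i(x)$ for all $x\in X$. -/

import Mathlib

universe u v w

namespace Nilspace

/-! ### Discrete cubes -/

/-- The discrete `n`-cube `{0,1}^n`. -/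
abbrev DCube (n : ℕ) : Type := Fin n → Bool

/-- The vertex `0^n`. -/
def zeroV (n : ℕ) : DCube n := fun _ => false

/-- The vertex `1^n`. -/
def oneV (n : ℕ) : DCube n := fun _ => true

/-- The inclusion `{0,1}^n ⊆ ℤ^n`. -/
def toInt {n : ℕ} (x : DCube n) : Fin n → ℤ := fun i => if x i then 1 else 0

/-- A discrete-cube morphism: the restriction of an affine homomorphism `ℤ^m → ℤ^n`. -/
def IsCubeMorphism {m n : ℕ} (φ : DCube m → DCube n) : Prop :=
  ∃ (A : (Fin m → ℤ) →+ (Fin n → ℤ)) (t : Fin n → ℤ), ∀ x, toInt (φ x) = A (toInt x) + t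

/-- The face map onto the `m`-dimensional face `{x : x i = 0}` of `{0,1}^(m+1)`.
These are exactly the codimension-one faces that contain `0^(m+1)`. -/
def lowerFace {m : ℕ} (i : Fin (m + 1)) (x : DCube m) : DCube (m + 1) :=
  Fin.insertNth (α := fun _ => Bool) i false x

theorem lowerFace_ne_oneV {m : ℕ} (i : Fin (m + 1)) (x : DCube m) :
    lowerFace i x ≠ oneV (m + 1) := by
  intro h
  have := congrFun h i
  simp [lowerFace, oneV] at this

/-! ### Cubespaces and nilspaces -/

/-- A cubespace structure on a set `X`. -/
structure Cubespace (X : Type u) where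
  /-- the set of `n`-cubes -/
  cubes : ∀ n : ℕ, Set (DCube n → X)
  /-- the composition axiom -/
  comp_mem : ∀ {m n : ℕ} (φ : DCube m → DCube n), IsCubeMorphism φ →
    ∀ q ∈ cubes n, q ∘ φ ∈ cubes m
  /-- every map `{0,1}^0 → X` is a cube -/
  cubes_zero : cubes 0 = Set.univ

namespace Cubespace

variable {X : Type u} {Y : Type v}

/-- `q'` is an `(m+1)`-corner: every restriction of `q'` to an `m`-face containing `0^(m+1)`
is a cube. -/
def IsCorner (C : Cubespace X) {m : ℕ} (q' : {x : DCube (m + 1) // x ≠ oneV (m + 1)} → X) :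
    Prop :=
  ∀ i : Fin (m + 1), (fun x : DCube m => q' ⟨lowerFace i x, lowerFace_ne_oneV i x⟩) ∈ C.cubes m

/-- `q` is a completion of the map `q'`. -/
def IsCompletion (C : Cubespace X) {m : ℕ} (q' : {x : DCube (m + 1) // x ≠ oneV (m + 1)} → X)
    (q : DCube (m + 1) → X) : Prop :=
  q ∈ C.cubes (m + 1) ∧ ∀ x : {x : DCube (m + 1) // x ≠ oneV (m + 1)}, q x.1 = q' x

/-- A cubespace is a nilspace if it satisfies ergodicity and corner completion. -/
structure IsNilspace (C : Cubespace X) : Prop where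
  ergodic : C.cubes 1 = Set.univ
  completion : ∀ (m : ℕ) (q' : {x : DCube (m + 1) // x ≠ oneV (m + 1)} → X),
    C.IsCorner q' → ∃ q, C.IsCompletion q' q

/-- A `k`-step nilspace: a nilspace in which every `(k+1)`-corner has a unique completion. -/
structure IsStepNilspace (C : Cubespace X) (k : ℕ) : Prop extends C.IsNilspace where
  unique_completion : ∀ q' : {x : DCube (k + 1) // x ≠ oneV (k + 1)} → X,
    C.IsCorner q' → ∃! q, C.IsCompletion q' q

/-- The cubespace structure on `Y` whose cubes are the images `f ∘ q` of the cubes `q` of `X`,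
for a surjection `f : X → Y`. -/
def image (C : Cubespace X) (f : X → Y) (hf : Function.Surjective f) : Cubespace Y where
  cubes n := {p | ∃ q ∈ C.cubes n, p = f ∘ q}
  comp_mem := by
    rintro m n φ hφ _ ⟨q, hq, rfl⟩
    exact ⟨q ∘ φ, C.comp_mem φ hφ q hq, rfl⟩
  cubes_zero := by
    refine Set.eq_univ_of_forall fun p => ?_
    choose g hg using hf
    refine ⟨g ∘ p, by rw [C.cubes_zero]; trivial, ?_⟩
    funext x
    exact (hg (p x)).symm

/-- The quotient cubespace `X / ∼`. -/
def quotient (C : Cubespace X) (s : Setoid X) : Cubespace (Quotient s) :=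
  C.image (Quotient.mk s) Quotient.mk_surjective

/-- A bijection is an isomorphism of cubespaces if it matches the cubes of all dimensions. -/
def IsIso (C : Cubespace X) (D : Cubespace Y) (φ : X ≃ Y) : Prop :=
  ∀ (n : ℕ) (q : DCube n → X), q ∈ C.cubes n ↔ φ ∘ q ∈ D.cubes n

/-- The relation `x ∼_k y`: there are two `(k+1)`-cubes with values `x` and `y` at `0^(k+1)`
that agree at all other vertices. -/
def sim (C : Cubespace X) (k : ℕ) (x y : X) : Prop :=
  ∃ q₀ ∈ C.cubes (k + 1), ∃ q₁ ∈ C.cubes (k + 1),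
    q₀ (zeroV (k + 1)) = x ∧ q₁ (zeroV (k + 1)) = y ∧ ∀ a, a ≠ zeroV (k + 1) → q₀ a = q₁ a

end Cubespace

/-! ### The degree-`k` structure on an abelian group -/

section Degree

variable (Z : Type w) [AddCommGroup Z]

/-- The maximal filtration of degree `k` on an abelian group:
`Z_0 = ⋯ = Z_k = Z` and `Z_j = 0` for `j > k`. -/
def degFiltration (k j : ℕ) : AddSubgroup Z := if j ≤ k then ⊤ else ⊥

variable {Z}

open Classical in
/-- The element `g^F` of `Z^({0,1}^n)`, equal to `g` on the face
`F = {y : y i = x i for all i ∈ I}` (of codimension `|I|`) and to `0` off `F`. -/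
noncomputable def faceElt {n : ℕ} (I : Finset (Fin n)) (x : DCube n) (g : Z) : DCube n → Z :=
  fun y => if ∀ i ∈ I, y i = x i then g else 0

variable (Z)

/-- The group of `n`-cubes of `𝓓_k(Z)`: the subgroup of `Z^({0,1}^n)` generated by the face
groups `{g^F : g ∈ Z_{codim F}}` of the maximal filtration of degree `k`. -/
def degCubes (k n : ℕ) : AddSubgroup (DCube n → Z) :=
  AddSubgroup.closure
    {c | ∃ (I : Finset (Fin n)) (x : DCube n), ∃ g ∈ degFiltration Z k I.card, c = faceElt I x g}

end Degree

/-! ### Abelian bundles -/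

/-- `B`, with the given action of the abelian group `Z` and the map `π : B → S`, is an abelian
bundle over `S` with structure group `Z`. -/
structure IsAbelianBundle (Z : Type w) [AddCommGroup Z] {B : Type u} {S : Type v} [AddAction Z B]
    (π : B → S) : Prop where
  /-- the action is free -/
  free : ∀ x : B, {z : Z | z +ᵥ x = x} = {0}
  /-- `s ↦ π⁻¹(s)` is a bijection from `S` to the set of orbits -/
  bijOn : Set.BijOn (fun s => π ⁻¹' {s}) Set.univ (Set.range fun x : B => AddAction.orbit Z x)

theorem IsAbelianBundle.surjective {Z : Type w} [AddCommGroup Z] {B : Type u} {S : Type v}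
    [AddAction Z B] {π : B → S} (h : IsAbelianBundle Z π) : Function.Surjective π := by
  intro s
  obtain ⟨x, hx⟩ := h.bijOn.mapsTo (Set.mem_univ s)
  have hx' : AddAction.orbit Z x = π ⁻¹' {s} := hx
  have hm : x ∈ π ⁻¹' {s} := by
    rw [← hx']
    exact AddAction.mem_orbit_self x
  exact ⟨x, hm⟩

/-- A `k`-fold abelian bundle structure on the set `X`: factors `B_0, …, B_k` with `B_0` a
singleton and `B_k` identified with `X`, such that `B_(i+1)` is an abelian bundle over `B_i`.
The structure group of `B_(i+1)` over `B_i` is `grp i`. -/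
structure KFoldBundle (k : ℕ) (X : Type u) where
  /-- the factors `B_0, …, B_k` -/
  factor : Fin (k + 1) → Type v
  /-- the structure groups; `grp i` acts on `B_(i+1)` -/
  grp : Fin k → Type w
  [addCommGroup : ∀ i, AddCommGroup (grp i)]
  [addAction : ∀ i, AddAction (grp i) (factor i.succ)]
  /-- the bundle map `B_(i+1) → B_i` -/
  proj : ∀ i : Fin k, factor i.succ → factor i.castSucc
  isBundle : ∀ i : Fin k, IsAbelianBundle (grp i) (proj i)
  base : ∃ b : factor 0, ∀ b' : factor 0, b' = b
  /-- the identification `X = B_k` -/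
  top : X ≃ factor (Fin.last k)

namespace KFoldBundle

attribute [instance] KFoldBundle.addCommGroup KFoldBundle.addAction

variable {k : ℕ} {X : Type u}

/-- The projection `π_i : X = B_k → B_i`, the composition of the bundle maps. -/
def toFactor (E : KFoldBundle.{u, v, w} k X) (i : Fin (k + 1)) : X → E.factor i :=
  Fin.reverseInduction (motive := fun i => X → E.factor i) E.top
    (fun i f => E.proj i ∘ f) i

theorem toFactor_surjective (E : KFoldBundle.{u, v, w} k X) (i : Fin (k + 1)) :
    Function.Surjective (E.toFactor i) := by
  induction i using Fin.reverseInduction with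
  | last =>
    have h : E.toFactor (Fin.last k) = E.top := by simp [toFactor]
    rw [h]
    exact E.top.surjective
  | cast i ih =>
    have h : E.toFactor i.castSucc = E.proj i ∘ E.toFactor i.succ := by simp [toFactor]
    rw [h]
    exact (E.isBundle i).surjective.comp ih

/-- The cubespace structure on the factor `B_i`, with `n`-cubes `π_i ∘ q` for `q` an `n`-cube
of `X`. -/
def factorCubespace (E : KFoldBundle.{u, v, w} k X) (C : Cubespace X) (i : Fin (k + 1)) :
    Cubespace (E.factor i) :=
  C.image (E.toFactor i) (E.toFactor_surjective i)

/-- The cubespace `X` with the `k`-fold abelian bundle structure `E` is a degree-`k` bundle: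
for every cube `q` of `B_(i+1)`, the cubes of `B_(i+1)` with the same projection to `B_i` as `q`
are exactly the translates of `q` by cubes of `𝓓_(i+1)` of the structure group. -/
def IsDegreeBundle (E : KFoldBundle.{u, v, w} k X) (C : Cubespace X) : Prop :=
  ∀ (i : Fin k) (n : ℕ), ∀ q ∈ (E.factorCubespace C i.succ).cubes n,
    {q₂ | q₂ ∈ (E.factorCubespace C i.succ).cubes n ∧ E.proj i ∘ q = E.proj i ∘ q₂} =
      {q₂ | ∃ q₃ ∈ degCubes (E.grp i) (i.val + 1) n, q₂ = fun a => q₃ a +ᵥ q a}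

end KFoldBundle

end Nilspace

/-! The geometric engine is corner completion in grid form: `cubeOn_glue` says that cubes fitting
together in a grid have a cube as their outer corners. Consequently `x ∼_i y` holds exactly when the
function equal to `y` at one vertex of the `(i+1)`-cube and to `x` at all others is a cube
(`sim_iff_rel`). Hence `∼_i` is an equivalence relation, and in dimension at most `i+1` values may
be replaced by equivalent ones without leaving the cubes (`CubeOn.congr_rel`). Corners of `X/∼_i`
can therefore be completed by lifting, and `X/∼_i` is an `i`-step nilspace
(`IsNilspace.isStepNilspace_image`).

For a `k`-step nilspace put `B_i = X/∼_i`. The structure group of `B_(i+1)` over `B_i` is its group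
of translations of height `i+1`. Completing parallelograms shows that this group is transitive on
fibres; unique completion shows that it acts freely and is abelian. A cube of `𝓓_j(Z)` is determined
by its values at the vertices of weight at most `j`, and these can be prescribed freely
(`degCubes_eq_zero`, `exists_mem_degCubes`). A cube of a `j`-step nilspace is determined by the same
vertices, and comparing the two facts gives the degree condition (`vadd_mem_iff_mem_degCubes`).

Conversely, `B_0` is a point, and a degree-`(s+1)` extension of an `s`-step nilspace is an
`(s+1)`-step nilspace (`IsStepNilspace.of_bundle`): complete the projected corner, lift the
completion, and correct the lift by a cube of `𝓓_(s+1)`. Every function on a cube of dimension at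
most `j` is a cube of `𝓓_j`, so the cubes of `X` of dimension at most `i+1` are all the lifts of
cubes of `B_i` (`IsDegreeBundle.mem_cubes`). Together with unique completion in `B_i` this
identifies the fibres of `π_i` with the classes of `∼_i`. -/

namespace Nilspace

/-! ### Cubes indexed by arbitrary types -/

/-- A coordinate function on `{0,1}^ι`: a constant, a coordinate or the negation of one. -/
def IsCoord {ι : Type*} (f : (ι → Bool) → Bool) : Prop :=
  (∃ b, ∀ x, f x = b) ∨ ∃ j b, ∀ x, f x = (b ^^ x j)

/-- A map of discrete cubes all of whose components are coordinate functions. -/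
def IsMorph {ι κ : Type*} (φ : (ι → Bool) → (κ → Bool)) : Prop :=
  ∀ i, IsCoord fun x => φ x i

section Morph

variable {ι κ μ : Type*}

theorem IsCoord.const (b : Bool) : IsCoord fun _ : ι → Bool => b := Or.inl ⟨b, fun _ => rfl⟩

theorem IsCoord.proj (j : ι) : IsCoord fun x : ι → Bool => x j :=
  Or.inr ⟨j, false, fun x => by simp⟩

theorem IsCoord.xor {f : (ι → Bool) → Bool} (hf : IsCoord f) (b : Bool) :
    IsCoord fun x => (b ^^ f x) := by
  rcases hf with ⟨c, hc⟩ | ⟨j, c, hc⟩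
  · exact Or.inl ⟨b ^^ c, fun x => by simp only [hc]⟩
  · exact Or.inr ⟨j, b ^^ c, fun x => by simp only [hc, Bool.xor_assoc]⟩

theorem IsCoord.not {f : (ι → Bool) → Bool} (hf : IsCoord f) : IsCoord fun x => !f x := by
  simpa using hf.xor true

theorem IsCoord.and {f : (ι → Bool) → Bool} (hf : IsCoord f) (b : Bool) :
    IsCoord fun x => (f x && b) := by
  cases b
  · simpa using IsCoord.const false
  · simpa using hf

theorem IsCoord.ite {f g : (ι → Bool) → Bool} (p : Prop) [Decidable p] (hf : IsCoord f)
    (hg : IsCoord g) : IsCoord fun x => if p then f x else g x := by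
  split_ifs
  · exact hf
  · exact hg

theorem IsCoord.comp {f : (κ → Bool) → Bool} {φ : (ι → Bool) → (κ → Bool)} (hf : IsCoord f)
    (hφ : IsMorph φ) : IsCoord fun x => f (φ x) := by
  rcases hf with ⟨c, hc⟩ | ⟨j, c, hc⟩
  · exact Or.inl ⟨c, fun x => hc _⟩
  · simp only [hc]
    exact (hφ j).xor c

theorem IsMorph.id : IsMorph fun x : ι → Bool => x := fun j => IsCoord.proj j

theorem IsMorph.const (v : κ → Bool) : IsMorph fun _ : ι → Bool => v := fun _ => IsCoord.const _

theorem IsMorph.comp {ψ : (κ → Bool) → (μ → Bool)} {φ : (ι → Bool) → (κ → Bool)} (hψ : IsMorph ψ)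
    (hφ : IsMorph φ) : IsMorph fun x => ψ (φ x) := fun j => (hψ j).comp hφ

theorem IsMorph.reindex (e : κ → ι) : IsMorph fun (x : ι → Bool) (j : κ) => x (e j) :=
  fun j => IsCoord.proj (e j)

theorem IsMorph.inf (v : ι → Bool) : IsMorph fun x : ι → Bool => x ⊓ v :=
  fun j => (IsCoord.proj j).and (v j)

theorem IsMorph.compl : IsMorph fun x : ι → Bool => xᶜ := fun j => (IsCoord.proj j).not

theorem IsMorph.isCubeMorphism {m n : ℕ} {φ : DCube m → DCube n} (hφ : IsMorph φ) :
    IsCubeMorphism φ := by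
  have key : ∀ i, ∃ (a : (Fin m → ℤ) →+ ℤ) (c : ℤ), ∀ x, toInt (φ x) i = a (toInt x) + c := by
    intro i
    rcases hφ i with ⟨b, hb⟩ | ⟨j, b, hb⟩
    · exact ⟨0, if b then 1 else 0, fun x => by simp [toInt, hb]⟩
    · cases b
      · exact ⟨Pi.evalAddMonoidHom _ j, 0, fun x => by simp [toInt, hb]⟩
      · refine ⟨-Pi.evalAddMonoidHom _ j, 1, fun x => ?_⟩
        cases h : x j <;> simp [toInt, hb, h]
  choose a c h using key
  exact ⟨AddMonoidHom.pi a, c, fun x => funext fun i => h i x⟩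

theorem isMorph_lowerFace {m : ℕ} (i : Fin (m + 1)) : IsMorph (lowerFace i) := by
  intro j
  refine Fin.succAboveCases i ?_ (fun j => ?_) j
  · simpa [lowerFace] using IsCoord.const false
  · simpa [lowerFace] using IsCoord.proj j

end Morph

/-- The function on `{0,1}^ι` with value `y` at `1^ι` and `x` elsewhere. -/
noncomputable def spike {ι : Type*} {X : Type*} (y x : X) (c : ι → Bool) : X :=
  open Classical in if c = ⊤ then y else x

section Spike

variable {ι κ : Type*} {X Y : Type*}

@[simp] theorem spike_top (y x : X) : spike y x (⊤ : ι → Bool) = y := by simp [spike]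

theorem spike_of_ne {c : ι → Bool} (h : c ≠ ⊤) (y x : X) : spike y x c = x := by simp [spike, h]

@[simp] theorem spike_self (x : X) (c : ι → Bool) : spike x x c = x := by simp [spike]

theorem spike_congr {c : ι → Bool} {c' : κ → Bool} (h : c = ⊤ ↔ c' = ⊤) (y x : X) :
    spike y x c = spike y x c' := by
  unfold spike
  by_cases hc : c = ⊤
  · rw [if_pos hc, if_pos (h.1 hc)]
  · rw [if_neg hc, if_neg (fun h' => hc (h.2 h'))]

theorem apply_spike (f : X → Y) (y x : X) (c : ι → Bool) :
    f (spike y x c) = spike (f y) (f x) c := by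
  unfold spike
  split_ifs <;> rfl

end Spike

/-! ### Corner completion over down-sets, and gluing of cubes. -/

namespace Cubespace

variable {X : Type u} {ι κ μ : Type*} (C : Cubespace X)

/-- `q : {0,1}^ι → X` is a cube, for an arbitrary index type `ι`. -/
def CubeOn (q : (ι → Bool) → X) : Prop :=
  ∀ (n : ℕ) (φ : DCube n → (ι → Bool)), IsMorph φ → q ∘ φ ∈ C.cubes n

variable {C}

theorem CubeOn.comp {q : (κ → Bool) → X} (hq : C.CubeOn q) {φ : (ι → Bool) → (κ → Bool)}
    (hφ : IsMorph φ) : C.CubeOn fun x => q (φ x) :=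
  fun n ψ hψ => hq n (fun x => φ (ψ x)) (hφ.comp hψ)

theorem cubeOn_iff {n : ℕ} {q : DCube n → X} : C.CubeOn q ↔ q ∈ C.cubes n :=
  ⟨fun h => h n _ IsMorph.id, fun h _ _ hφ => C.comp_mem _ hφ.isCubeMorphism _ h⟩

theorem cubeOn_const (x : X) : C.CubeOn fun _ : ι → Bool => x := by
  intro n φ _
  have h : (fun _ => x) ∈ C.cubes 0 := by rw [C.cubes_zero]; trivial
  exact C.comp_mem (fun _ => fun i => i.elim0) (IsMorph.isCubeMorphism fun i => i.elim0) _ h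

/-- The number of coordinates of `u` equal to `1`. -/
def _root_.Nilspace.weight [Fintype ι] (u : ι → Bool) : ℕ :=
  (Finset.univ.filter fun i => u i = true).card

theorem _root_.Nilspace.weight_lt [Fintype ι] {u v : ι → Bool} (h : u < v) :
    weight u < weight v := by
  obtain ⟨hle, i, hi⟩ := Pi.lt_def.1 h
  refine Finset.card_lt_card ⟨fun j hj => ?_, fun hs => ?_⟩
  · simp only [Finset.mem_filter, Finset.mem_univ, true_and] at hj ⊢
    have := hle j
    rw [hj] at this
    exact top_le_iff.1 this
  · have hvi : v i = true := by
      cases hv : v i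
      · rw [hv] at hi; exact absurd hi (by simp)
      · rfl
    have := hs (Finset.mem_filter.2 ⟨Finset.mem_univ i, hvi⟩)
    simp only [Finset.mem_filter, Finset.mem_univ, true_and] at this
    rw [hvi, this] at hi
    exact lt_irrefl _ hi

/-- The face `[0, v]` is a discrete cube, on which `f` is a corner. Its completion is spread to the
whole cube by forgetting the coordinates outside the support of `v`. -/
theorem exists_cubeOn_of_lt [Finite ι] (hC : C.IsNilspace) {f : (ι → Bool) → X} (v : ι → Bool)
    (hf : ∀ u < v, C.CubeOn fun x => f (x ⊓ u)) : ∃ g, C.CubeOn g ∧ ∀ u < v, g u = f u := by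
  classical
  have := Fintype.ofFinite ι
  by_cases hv : v = ⊥
  · exact ⟨fun _ => f ⊥, cubeOn_const _, fun u hu => by simp [hv] at hu⟩
  obtain ⟨m, hm⟩ : ∃ m, Fintype.card {i // v i = true} = m + 1 := by
    refine Nat.exists_eq_succ_of_ne_zero fun h => hv ?_
    rw [Fintype.card_eq_zero_iff] at h
    funext i
    by_contra hi
    exact h.elim ⟨i, by simpa using hi⟩
  let e : Fin (m + 1) ≃ {i // v i = true} := (Fintype.equivFinOfCardEq hm).symm
  let E : DCube (m + 1) → (ι → Bool) := fun c i => if h : v i = true then c (e.symm ⟨i, h⟩) else false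
  have hE : IsMorph E := by
    intro i
    by_cases h : v i = true
    · simpa [E, h] using IsCoord.proj _
    · simpa [E, h] using IsCoord.const false
  have hle : ∀ c, E c ≤ v := by
    intro c i
    by_cases h : v i = true
    · rw [h]; exact le_top
    · simp [E, h]
  have hRE : ∀ u ≤ v, E (fun j => u (e j)) = u := by
    intro u hu
    funext i
    by_cases h : v i = true
    · simp [E, h]
    · have := hu i
      simp only [Bool.not_eq_true] at h
      rw [h] at this
      simp [E, h, le_bot_iff.1 this]
  have hER : ∀ c j, E c (e j) = c j := by
    intro c j
    have := (e j).2
    simp [E, this]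
  have hcor : C.IsCorner (fun x : {x : DCube (m + 1) // x ≠ oneV (m + 1)} => f (E x.1)) := by
    intro i
    let u : ι → Bool := E (lowerFace i ⊤)
    have hu : u < v := by
      refine lt_of_le_of_ne (hle _) fun h => ?_
      have h1 := congrFun h (e i)
      rw [(e i).2] at h1
      replace h1 := (hER _ _).symm.trans h1
      simp [lowerFace] at h1
    have := (hf u hu).comp (hE.comp (isMorph_lowerFace i))
    rw [← cubeOn_iff]
    convert this using 3 with x
    refine (inf_eq_left.2 fun j => ?_).symm
    by_cases h : v j = true
    · simp only [E, h, u, dif_pos]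
      generalize e.symm ⟨j, h⟩ = l
      refine Fin.succAboveCases i ?_ (fun j => ?_) l
      · simp [lowerFace]
      · simp [lowerFace]
    · simp [E, h]
  obtain ⟨q, hq, hqf⟩ := hC.completion m _ hcor
  refine ⟨fun x => q fun j => x (e j), (cubeOn_iff.2 hq).comp (IsMorph.reindex _), fun u hu => ?_⟩
  have hne : (fun j => u (e j)) ≠ oneV (m + 1) := by
    intro h
    have h1 := hRE u hu.le
    rw [h] at h1
    refine hu.ne (h1.symm.trans (Eq.trans ?_ (hRE v le_rfl)))
    exact congrArg E (funext fun j => (e j).2.symm)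
  refine Eq.trans ?_ (congrArg f (hRE u hu.le))
  exact hqf ⟨_, hne⟩

/-- Construction of a cube by recursion on the vertices, with a constraint on each value. -/
theorem exists_cubeOn_forall [Finite ι] [Nonempty X] {Q : (ι → Bool) → X → Prop}
    (h : ∀ (u : ι → Bool) (f : (ι → Bool) → X),
      (∀ w < u, C.CubeOn (fun x => f (x ⊓ w)) ∧ Q w (f w)) →
      ∃ g, C.CubeOn g ∧ (∀ w < u, g w = f w) ∧ Q u (g u)) :
    ∃ f, C.CubeOn f ∧ ∀ u, Q u (f u) := by
  classical
  have := Fintype.ofFinite ι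
  -- Recursion on the weight: the choices at different vertices of weight `m` are independent, since
  -- each lower face `[0, u]` with `weight u = m` contains only one such vertex.
  have key : ∀ m, ∃ f : (ι → Bool) → X, ∀ u, weight u < m →
      C.CubeOn (fun x => f (x ⊓ u)) ∧ Q u (f u) := by
    intro m
    induction m with
    | zero => exact ⟨fun _ => Classical.arbitrary X, fun u hu => absurd hu (by simp)⟩
    | succ m ih =>
      obtain ⟨f, hf⟩ := ih
      have hg : ∀ u : ι → Bool, ∃ g : (ι → Bool) → X, weight u = m →
          C.CubeOn g ∧ (∀ w < u, g w = f w) ∧ Q u (g u) := by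
        intro u
        by_cases hu : weight u = m
        · obtain ⟨g, hg⟩ := h u f fun w hw => hf w (hu ▸ weight_lt hw)
          exact ⟨g, fun _ => hg⟩
        · exact ⟨f, fun h' => absurd h' hu⟩
      choose G hG using hg
      refine ⟨fun u => if weight u = m then G u u else f u, fun u hu => ?_⟩
      rcases Nat.lt_succ_iff_lt_or_eq.1 hu with hu | hu
      · have h1 : ∀ x : ι → Bool, weight (x ⊓ u) ≠ m := by
          intro x
          rcases (inf_le_right : x ⊓ u ≤ u).lt_or_eq with h2 | h2
          · have := weight_lt h2; omega
          · rw [h2]; omega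
        simpa [h1, hu.ne] using hf u hu
      · obtain ⟨h1, h2, h3⟩ := hG u hu
        refine ⟨?_, by simpa [hu] using h3⟩
        convert h1.comp (IsMorph.inf u) using 2 with x
        rcases (inf_le_right : x ⊓ u ≤ u).lt_or_eq with h4 | h4
        · have := weight_lt h4
          simp only
          rw [if_neg (by omega), h2 _ h4]
        · simp only
          rw [h4, if_pos hu]
  obtain ⟨f, hf⟩ := key (weight (⊤ : ι → Bool) + 1)
  refine ⟨f, by simpa using (hf ⊤ (Nat.lt_succ_self _)).1, fun u => (hf u ?_).2⟩
  rcases (le_top : u ≤ ⊤).lt_or_eq with h1 | h1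
  · exact (weight_lt h1).trans (Nat.lt_succ_self _)
  · rw [h1]; exact Nat.lt_succ_self _

/-- A function that is a cube on every `[0, v]` in a down-set agrees there with a cube. -/
theorem exists_cubeOn_extend [Finite ι] (hC : C.IsNilspace) {S : Set (ι → Bool)}
    (hS : IsLowerSet S) {f : (ι → Bool) → X} (hf : ∀ u ∈ S, C.CubeOn fun x => f (x ⊓ u)) :
    ∃ g, C.CubeOn g ∧ ∀ u ∈ S, g u = f u := by
  have : Nonempty X := ⟨f ⊥⟩
  refine exists_cubeOn_forall (Q := fun u y => u ∈ S → y = f u) fun u g hg => ?_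
  by_cases hu : u ∈ S
  · refine ⟨fun x => f (x ⊓ u), hf u hu, fun w hw => ?_, fun _ => by simp⟩
    simp only
    rw [(hg w hw).2 (hS hw.le hu), inf_eq_left.2 hw.le]
  · obtain ⟨g', h1, h2⟩ := exists_cubeOn_of_lt hC u fun w hw => (hg w hw).1
    exact ⟨g', h1, h2, fun h => absurd h hu⟩

/-- Gluing of cubes arranged in a grid `{0,1,2}^ι × {0,1}^κ`. -/
theorem cubeOn_glue [Finite ι] [Finite κ] (hC : C.IsNilspace)
    {f : (ι → Bool) → (ι → Bool) → (κ → Bool) → X}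
    (hf : ∀ J : ι → Bool, C.CubeOn fun z : ι ⊕ κ → Bool =>
      f ((fun i => z (.inl i)) ⊓ J) ((fun i => z (.inl i)) ⊓ Jᶜ) fun j => z (.inr j)) :
    C.CubeOn fun z : ι ⊕ κ → Bool =>
      f (fun i => z (.inl i)) (fun i => z (.inl i))ᶜ fun j => z (.inr j) := by
  classical
  -- Two bits encode a grid coordinate: `(0,0)` is the middle point, `(1,0)` and `(0,1)` are the
  -- ends. The grid is thus a down-set in a larger cube, to which `f` extends.
  let S : Set (ι ⊕ ι ⊕ κ → Bool) := {z | ∀ i, z (.inl i) = true → z (.inr (.inl i)) = false}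
  have hS : IsLowerSet S := by
    intro z z' hz h i hi
    have h1 := hz (.inl i)
    have h2 := hz (.inr (.inl i))
    rw [hi] at h1
    rw [h i (top_le_iff.1 h1)] at h2
    exact le_bot_iff.1 h2
  obtain ⟨g, hg, hgf⟩ := exists_cubeOn_extend hC hS
    (f := fun z => f (fun i => z (.inl i)) (fun i => z (.inr (.inl i))) fun j => z (.inr (.inr j)))
    (by
      intro u hu
      let φ : (ι ⊕ ι ⊕ κ → Bool) → (ι ⊕ κ → Bool) := fun x =>
        Sum.elim (fun i => if u (.inl i) = true then x (.inl i)
          else (x (.inr (.inl i)) && u (.inr (.inl i))))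
          (fun j => x (.inr (.inr j)) && u (.inr (.inr j)))
      have hφ : IsMorph φ := by
        rintro (i | j)
        · exact IsCoord.ite _ (IsCoord.proj _) ((IsCoord.proj _).and _)
        · exact (IsCoord.proj _).and _
      convert (hf fun i => u (.inl i)).comp hφ using 2 with x
      congr 1
      · funext i
        by_cases h : u (.inl i) = true <;> simp [φ, h]
      · funext i
        by_cases h : u (.inl i) = true
        · simp [φ, h, hu i h]
        · simp [φ, h])
  -- The outer corners of the grid form a diagonal subcube of the larger cube.
  let ψ : (ι ⊕ κ → Bool) → (ι ⊕ ι ⊕ κ → Bool) := fun z =>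
    Sum.elim (fun i => z (.inl i)) (Sum.elim (fun i => !z (.inl i)) fun j => z (.inr j))
  have hψ : IsMorph ψ := by
    rintro (i | i | j)
    · exact IsCoord.proj _
    · exact (IsCoord.proj _).not
    · exact IsCoord.proj _
  convert hg.comp hψ using 2 with z
  rw [hgf _ fun i hi => by simpa [ψ] using hi]
  rfl

/-- Glue reflected copies of faces of `q` to the cube in `hp`: the latter is the block `J = ⊤`, and
in all other blocks the new value `h` never occurs. -/
theorem cubeOn_replace [Finite ι] [Finite κ] (hC : C.IsNilspace) {q : (ι ⊕ κ → Bool) → X}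
    {h : (κ → Bool) → X} (hq : C.CubeOn q)
    (hp : C.CubeOn fun z : ι ⊕ κ → Bool => spike (h fun j => z (.inr j))
      (q (Sum.elim ⊤ fun j => z (.inr j))) fun i => z (.inl i)) :
    C.CubeOn fun z : ι ⊕ κ → Bool => spike (h fun j => z (.inr j)) (q z) fun i => z (.inl i) := by
  have := cubeOn_glue hC (f := fun a b w => spike (h w) (q (Sum.elim bᶜ w)) (a : ι → Bool)) (by
    intro J
    by_cases hJ : J = ⊤
    · subst hJ
      simpa using hp
    · have h1 : ∀ c : ι → Bool, c ⊓ J ≠ ⊤ := fun c hc => hJ (top_le_iff.1 (hc ▸ inf_le_right))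
      simp only [spike_of_ne (h1 _)]
      refine hq.comp (φ := fun z : ι ⊕ κ → Bool =>
        Sum.elim ((fun i => z (.inl i)) ⊓ Jᶜ)ᶜ fun j => z (.inr j)) ?_
      rintro (i | j)
      · exact ((IsCoord.proj _).and _).not
      · exact IsCoord.proj _)
  convert this using 2 with z
  congr 1
  · congr 1
    funext i
    cases i <;> simp

/-- Glue `q₁` (the block `J = ⊤`) to copies of `q₀`. At the outer corners `a ⊔ aᶜ = ⊤`, so only the
values on the top face survive. -/
theorem cubeOn_spike_top [Finite ι] [Finite κ] (hC : C.IsNilspace) {q₀ q₁ : (ι ⊕ κ → Bool) → X}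
    (h₀ : C.CubeOn q₀) (h₁ : C.CubeOn q₁)
    (h : ∀ z, (fun i => z (.inl i)) ≠ (⊤ : ι → Bool) → q₀ z = q₁ z) :
    C.CubeOn fun z : ι ⊕ κ → Bool => spike (q₁ (Sum.elim ⊤ fun j => z (.inr j)))
      (q₀ (Sum.elim ⊤ fun j => z (.inr j))) fun i => z (.inl i) := by
  have := cubeOn_glue hC (f := fun a b w =>
      spike (q₁ (Sum.elim ⊤ w)) (q₀ (Sum.elim (a ⊔ b) w)) (a : ι → Bool)) (by
    intro J
    by_cases hJ : J = ⊤
    · subst hJ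
      convert h₁ using 2 with z
      have hz : Sum.elim (fun i => z (.inl i)) (fun j => z (.inr j)) = z := by
        funext i
        cases i <;> rfl
      by_cases hc : (fun i => z (.inl i)) = (⊤ : ι → Bool)
      · rw [inf_top_eq, hc, spike_top, ← hc, hz]
      · rw [inf_top_eq, spike_of_ne hc, ← h z hc]
        simp [hz]
    · have h1 : ∀ c : ι → Bool, c ⊓ J ≠ ⊤ := fun c hc => hJ (top_le_iff.1 (hc ▸ inf_le_right))
      simp only [spike_of_ne (h1 _)]
      convert h₀ using 2 with z
      congr 1
      funext i
      cases i
      · simp [← inf_sup_left]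
      · simp)
  convert this using 2 with z
  simp

end Cubespace
end Nilspace

namespace Nilspace

namespace Cubespace

variable {X : Type u} {Y : Type v} {ι κ μ : Type*} {C : Cubespace X}

/-! ### The relations `∼` -/

variable (C) in
/-- The function equal to `y` at `1^ι` and to `x` elsewhere is a cube. -/
def Rel (ι : Type*) (x y : X) : Prop := C.CubeOn fun c : ι → Bool => spike y x c

theorem Rel.refl (x : X) : C.Rel ι x x := by
  simpa [Rel] using cubeOn_const x

theorem _root_.Nilspace.isMorph_extend (e : κ ↪ ι) (v : ι → Bool) :
    IsMorph fun c : κ → Bool => Function.extend e c v := by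
  intro i
  by_cases hi : ∃ j, e j = i
  · obtain ⟨j, rfl⟩ := hi
    simpa only [e.injective.extend_apply] using IsCoord.proj j
  · simpa only [Function.extend_apply' _ _ _ hi] using IsCoord.const (v i)

theorem _root_.Nilspace.extend_eq_iff (e : κ ↪ ι) (v : ι → Bool) (c : κ → Bool) :
    Function.extend e c v = v ↔ ∀ j, c j = v (e j) := by
  refine ⟨fun h j => by rw [← e.injective.extend_apply c v j, h], fun h => funext fun i => ?_⟩
  by_cases hi : ∃ j, e j = i
  · obtain ⟨j, rfl⟩ := hi
    rw [e.injective.extend_apply, h]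
  · rw [Function.extend_apply' _ _ _ hi]

theorem cubeOn_spike_embedding {a b : (μ → Bool) → X}
    (h : C.CubeOn fun z : ι ⊕ μ → Bool =>
      spike (a fun j => z (.inr j)) (b fun j => z (.inr j)) fun i => z (.inl i)) (e : κ ↪ ι) :
    C.CubeOn fun z : κ ⊕ μ → Bool =>
      spike (a fun j => z (.inr j)) (b fun j => z (.inr j)) fun i => z (.inl i) := by
  have hφ : IsMorph fun z : κ ⊕ μ → Bool =>
      Sum.elim (Function.extend e (fun i => z (.inl i)) ⊤) fun j => z (.inr j) := by
    rintro (i | j)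
    · exact ((isMorph_extend e ⊤).comp (IsMorph.reindex Sum.inl)) i
    · exact IsCoord.proj _
  refine (congrArg C.CubeOn (funext fun z => spike_congr ?_ _ _)).mp (h.comp hφ)
  exact (extend_eq_iff e ⊤ fun i => z (.inl i)).trans funext_iff.symm

theorem Rel.of_embedding {x y : X} (h : C.Rel ι x y) (e : κ ↪ ι) : C.Rel κ x y := by
  refine (congrArg C.CubeOn (funext fun c => spike_congr ?_ y x)).mp (h.comp (isMorph_extend e ⊤))
  exact (extend_eq_iff e ⊤ _).trans funext_iff.symm

theorem Rel.of_card_le [Fintype ι] {n : ℕ} {x y : X} (h : C.Rel (Fin n) x y)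
    (hn : Fintype.card ι ≤ n) : C.Rel ι x y :=
  h.of_embedding (Function.Embedding.nonempty_of_card_le (by simpa using hn)).some

theorem cubeOn_spike [Finite ι] (hC : C.IsNilspace) {q : (ι → Bool) → X} (hq : C.CubeOn q) {y : X}
    (h : C.Rel ι (q ⊤) y) : C.CubeOn fun c => spike y (q c) c := by
  have h1 := cubeOn_replace hC (ι := ι) (κ := Empty) (q := fun z => q fun i => z (.inl i))
    (h := fun _ => y) (hq.comp (IsMorph.reindex _)) (h.comp (IsMorph.reindex _))
  refine (h1.comp (φ := fun c => Sum.elim c ⊥) ?_ :)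
  rintro (i | i)
  · exact IsCoord.proj i
  · exact i.elim

theorem rel_of_agree [Finite ι] (hC : C.IsNilspace) {q₀ q₁ : (ι → Bool) → X}
    (h₀ : C.CubeOn q₀) (h₁ : C.CubeOn q₁) (h : ∀ c, c ≠ ⊤ → q₀ c = q₁ c) :
    C.Rel ι (q₀ ⊤) (q₁ ⊤) := by
  have h1 := cubeOn_spike_top hC (ι := ι) (κ := Empty) (h₀.comp (IsMorph.reindex Sum.inl))
    (h₁.comp (IsMorph.reindex Sum.inl)) fun z hz => h _ hz
  refine (h1.comp (φ := fun c => Sum.elim c ⊥) ?_ :)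
  rintro (i | i)
  · exact IsCoord.proj i
  · exact i.elim

theorem Rel.symm [Finite ι] (hC : C.IsNilspace) {x y : X} (h : C.Rel ι x y) : C.Rel ι y x := by
  have := rel_of_agree hC h (cubeOn_const x) fun c hc => spike_of_ne hc _ _
  rwa [spike_top] at this

theorem Rel.trans [Finite ι] (hC : C.IsNilspace) {x y z : X} (h : C.Rel ι x y)
    (h' : C.Rel ι y z) : C.Rel ι x z := by
  have h1 := cubeOn_spike hC h (y := z) (by rwa [spike_top])
  refine (congrArg C.CubeOn (funext fun c => ?_)).mp h1
  by_cases hc : c = ⊤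
  · simp [hc]
  · simp [spike_of_ne hc]

theorem cubeOn_update [Finite ι] [DecidableEq (ι → Bool)] (hC : C.IsNilspace)
    {q : (ι → Bool) → X} (hq : C.CubeOn q) {y : X} (v : ι → Bool) (h : C.Rel ι (q v) y) :
    C.CubeOn (Function.update q v y) := by
  -- The reflection of the cube that exchanges `⊤` and `v`.
  let φ : (ι → Bool) → (ι → Bool) := fun c i => !v i ^^ c i
  have hφ : IsMorph φ := fun i => (IsCoord.proj i).xor _
  have hφφ : ∀ c, φ (φ c) = c := fun c => funext fun i => by simp [φ]
  have hv : φ ⊤ = v := funext fun i => by simp [φ]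
  have h1 := (cubeOn_spike hC (hq.comp hφ) (y := y) (by rwa [hv])).comp hφ
  refine (congrArg C.CubeOn (funext fun c => ?_)).mp h1
  by_cases hc : c = v
  · have : φ c = ⊤ := by rw [hc, ← hv, hφφ]
    rw [this, spike_top, hc, Function.update_self]
  · have : φ c ≠ ⊤ := fun h => hc (by rw [← hv, ← h, hφφ])
    rw [spike_of_ne this, hφφ, Function.update_of_ne hc]

/-- Cubes of dimension at most `n` are unions of `Rel (Fin n)`-classes. -/
theorem CubeOn.congr_rel [Fintype ι] {n : ℕ} (hC : C.IsNilspace) (hn : Fintype.card ι ≤ n)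
    {q q' : (ι → Bool) → X} (hq : C.CubeOn q) (h : ∀ v, C.Rel (Fin n) (q v) (q' v)) :
    C.CubeOn q' := by
  classical
  have key : ∀ T : Finset (ι → Bool), C.CubeOn fun v => if v ∈ T then q' v else q v := by
    intro T
    induction T using Finset.induction_on with
    | empty => simpa using hq
    | insert v T hv ih =>
      refine (congrArg C.CubeOn (funext fun c => ?_)).mp
        (cubeOn_update hC ih v (y := q' v) (by simpa [hv] using (h v).of_card_le hn))
      by_cases hc : c = v
      · simp [hc]
      · simp [hc]
  simpa using key Finset.univ

theorem CubeOn.congr_rel_of_weight [Fintype ι] {n : ℕ} (hC : C.IsNilspace) {u : ι → Bool}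
    (hn : weight u ≤ n) {q q' : (ι → Bool) → X} (hq : C.CubeOn q)
    (h : ∀ v ≤ u, C.Rel (Fin n) (q v) (q' v)) : C.CubeOn fun x => q' (x ⊓ u) := by
  classical
  let E : ({i // u i = true} → Bool) → (ι → Bool) := fun c i =>
    if h : u i = true then c ⟨i, h⟩ else false
  have hE : IsMorph E := by
    intro i
    by_cases h : u i = true
    · simpa [E, h] using IsCoord.proj _
    · simpa [E, h] using IsCoord.const false
  have hle : ∀ c, E c ≤ u := by
    intro c i
    by_cases h : u i = true
    · rw [h]; exact le_top
    · simp [E, h]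
  have h1 := (hq.comp hE).congr_rel hC
    (by rw [Fintype.card_subtype]; exact hn) (q' := fun c => q' (E c)) fun c => h _ (hle c)
  refine (congrArg C.CubeOn (funext fun x => congrArg q' (funext fun i => ?_))).mp
    (h1.comp (IsMorph.reindex fun i : {i // u i = true} => i.1))
  by_cases h : u i = true <;> simp [E, h]

/-- Complementing all coordinates moves the exceptional vertex from `0` to `⊤`; then `rel_of_agree`
makes the common values constant. -/
theorem sim_iff_rel (hC : C.IsNilspace) {k : ℕ} {x y : X} :
    C.sim k x y ↔ C.Rel (Fin (k + 1)) x y := by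
  have hz : ∀ c : DCube (k + 1), c = ⊤ ↔ cᶜ = zeroV (k + 1) := by
    intro c
    rw [compl_eq_comm, eq_comm]
    exact Iff.of_eq (congrArg (· = c) (funext fun i => by simp [zeroV]))
  constructor
  · rintro ⟨q₀, h₀, q₁, h₁, rfl, rfl, h⟩
    have := rel_of_agree hC ((cubeOn_iff.2 h₀).comp IsMorph.compl)
      ((cubeOn_iff.2 h₁).comp IsMorph.compl) fun c hc => h _ fun h' => hc ((hz c).2 h')
    rwa [(hz ⊤).1 rfl] at this
  · intro h
    have h0 : (zeroV (k + 1))ᶜ = ⊤ := by rw [hz, compl_compl]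
    refine ⟨fun _ => x, cubeOn_iff.1 (cubeOn_const x), _, cubeOn_iff.1 (h.comp IsMorph.compl),
      rfl, ?_, fun a ha => ?_⟩
    · rw [h0, spike_top]
    · rw [spike_of_ne]
      exact fun h' => ha (by rw [← compl_compl a, h', ← h0, compl_compl])

theorem sim_equivalence (hC : C.IsNilspace) (k : ℕ) : Equivalence (C.sim k) where
  refl x := (sim_iff_rel hC).2 (Rel.refl x)
  symm h := (sim_iff_rel hC).2 (((sim_iff_rel hC).1 h).symm hC)
  trans h h' := (sim_iff_rel hC).2 (((sim_iff_rel hC).1 h).trans hC ((sim_iff_rel hC).1 h'))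

/-! ### Uniqueness of completions -/

theorem IsStepNilspace.of_unique {k : ℕ} (hC : C.IsNilspace)
    (h : ∀ q₀ q₁ : DCube (k + 1) → X, C.CubeOn q₀ → C.CubeOn q₁ → (∀ c, c ≠ ⊤ → q₀ c = q₁ c) →
      q₀ ⊤ = q₁ ⊤) : C.IsStepNilspace k := by
  refine ⟨hC, fun q' hq' => ?_⟩
  obtain ⟨q, hq⟩ := hC.completion k q' hq'
  refine ⟨q, hq, fun p hp => funext fun c => ?_⟩
  have hne : ∀ c, c ≠ ⊤ → p c = q c := fun c hc => (hp.2 ⟨c, hc⟩).trans (hq.2 ⟨c, hc⟩).symm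
  by_cases hc : c = ⊤
  · rw [hc]
    exact h _ _ (cubeOn_iff.2 hp.1) (cubeOn_iff.2 hq.1) hne
  · exact hne c hc

theorem IsStepNilspace.eq_top {k : ℕ} (hC : C.IsStepNilspace k) {q₀ q₁ : DCube (k + 1) → X}
    (h₀ : C.CubeOn q₀) (h₁ : C.CubeOn q₁) (h : ∀ c, c ≠ ⊤ → q₀ c = q₁ c) : q₀ ⊤ = q₁ ⊤ := by
  have hcor : C.IsCorner fun x : {x : DCube (k + 1) // x ≠ oneV (k + 1)} => q₀ x.1 := fun i =>
    cubeOn_iff.1 (h₀.comp (isMorph_lowerFace i))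
  have := (hC.unique_completion _ hcor).unique (y₁ := q₀) (y₂ := q₁)
    ⟨cubeOn_iff.1 h₀, fun _ => rfl⟩ ⟨cubeOn_iff.1 h₁, fun x => (h _ x.2).symm⟩
  rw [this]

/-- A vertex of weight above `k` is the top of a `(k+1)`-face inside `[0, v]`. Only uniqueness is
assumed, because the lemma is also applied to a quotient not yet known to have completions. -/
theorem eq_of_agree_lt [Fintype ι] {k : ℕ}
    (hu : ∀ q₀ q₁ : DCube (k + 1) → X, C.CubeOn q₀ → C.CubeOn q₁ → (∀ c, c ≠ ⊤ → q₀ c = q₁ c) →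
      q₀ ⊤ = q₁ ⊤)
    {q₀ q₁ : (ι → Bool) → X} (h₀ : C.CubeOn q₀) (h₁ : C.CubeOn q₁) {v : ι → Bool}
    (hv : k < weight v) (h : ∀ w < v, q₀ w = q₁ w) : q₀ v = q₁ v := by
  classical
  have hcard : Fintype.card (Fin (k + 1)) ≤ Fintype.card {i // v i = true} := by
    rw [Fintype.card_subtype, Fintype.card_fin]
    exact hv
  obtain ⟨e⟩ := Function.Embedding.nonempty_of_card_le hcard
  let e' : Fin (k + 1) ↪ ι := e.trans (Function.Embedding.subtype _)
  have hφ := isMorph_extend e' v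
  have hle : ∀ c, Function.extend e' c v ≤ v := by
    intro c i
    by_cases hi : ∃ j, e' j = i
    · obtain ⟨j, rfl⟩ := hi
      rw [show v (e' j) = true from (e j).2]
      exact le_top
    · rw [Function.extend_apply' _ _ _ hi]
  have htop : Function.extend e' ⊤ v = v := (extend_eq_iff e' v ⊤).2 fun j => (e j).2.symm
  have := hu _ _ (h₀.comp hφ) (h₁.comp hφ) fun c hc => h _ <| (hle c).lt_of_ne fun hcv => hc <|
    funext fun j => ((extend_eq_iff e' v c).1 hcv j).trans (e j).2
  rwa [htop] at this

theorem IsStepNilspace.eq_of_agree_lt [Fintype ι] {k : ℕ} (hC : C.IsStepNilspace k)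
    {q₀ q₁ : (ι → Bool) → X} (h₀ : C.CubeOn q₀) (h₁ : C.CubeOn q₁) {v : ι → Bool}
    (hv : k < weight v) (h : ∀ w < v, q₀ w = q₁ w) : q₀ v = q₁ v :=
  Cubespace.eq_of_agree_lt (fun _ _ => hC.eq_top) h₀ h₁ hv h

/-! ### The factors of a nilspace -/

theorem CubeOn.image {f : X → Y} (hf : Function.Surjective f) {q : (ι → Bool) → X}
    (hq : C.CubeOn q) : (C.image f hf).CubeOn fun v => f (q v) :=
  fun n φ hφ => ⟨q ∘ φ, hq n φ hφ, rfl⟩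

theorem CubeOn.exists_of_image {f : X → Y} {hf : Function.Surjective f} {n : ℕ}
    {p : DCube n → Y} (hp : (C.image f hf).CubeOn p) : ∃ q, C.CubeOn q ∧ ∀ v, p v = f (q v) := by
  obtain ⟨q, hq, h⟩ := cubeOn_iff.1 hp
  exact ⟨q, cubeOn_iff.2 hq, congrFun h⟩

/-- A corner is lifted vertex by vertex. Up to weight `k+1` any lift of the prescribed value is
admissible, as cubes there are unions of classes; beyond that, any completion projects to the right
value by uniqueness. -/
theorem IsNilspace.isStepNilspace_image (hC : C.IsNilspace) {k : ℕ} {f : X → Y}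
    (hf : Function.Surjective f) (hfr : ∀ x y, f x = f y ↔ C.Rel (Fin (k + 1)) x y) :
    (C.image f hf).IsStepNilspace k := by
  classical
  have hu : ∀ p₀ p₁ : DCube (k + 1) → Y, (C.image f hf).CubeOn p₀ → (C.image f hf).CubeOn p₁ →
      (∀ c, c ≠ ⊤ → p₀ c = p₁ c) → p₀ ⊤ = p₁ ⊤ := by
    intro p₀ p₁ hp₀ hp₁ h
    obtain ⟨q₀, h₀, e₀⟩ := hp₀.exists_of_image
    obtain ⟨q₁, h₁, e₁⟩ := hp₁.exists_of_image
    -- In dimension `k+1` the values of `q₁` off `⊤` can be exchanged for the equivalent values of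
    -- `q₀`.
    have h2 : C.CubeOn fun c => spike (q₁ ⊤) (q₀ c) c := by
      refine h₁.congr_rel (n := k + 1) hC (by simp) fun c => ?_
      by_cases hc : c = ⊤
      · rw [hc, spike_top]
        exact Rel.refl _
      · rw [spike_of_ne hc, ← hfr, ← e₀, ← e₁, h c hc]
    have h3 := rel_of_agree hC h₀ h2 fun c hc => (spike_of_ne hc _ _).symm
    rw [e₀, e₁, hfr]
    simpa using h3
  refine IsStepNilspace.of_unique ⟨?_, fun m q' hq' => ?_⟩ hu
  · refine Set.eq_univ_of_forall fun p => ?_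
    refine ⟨fun x => (hf (p x)).choose, by rw [hC.ergodic]; trivial, funext fun x => ?_⟩
    exact (hf (p x)).choose_spec.symm
  · let h : DCube (m + 1) → X := fun u =>
      if hu : u = oneV (m + 1) then (hf (q' ⟨zeroV (m + 1), fun h => by
        simpa [zeroV, oneV] using congrFun h 0⟩)).choose else (hf (q' ⟨u, hu⟩)).choose
    have hh : ∀ u (hu : u ≠ oneV (m + 1)), f (h u) = q' ⟨u, hu⟩ := by
      intro u hu
      simp only [h, dif_neg hu]
      exact (hf (q' ⟨u, hu⟩)).choose_spec
    have hp : ∀ u : DCube (m + 1), u ≠ ⊤ → ∃ p, C.CubeOn p ∧ ∀ w, f (p w) = f (h (w ⊓ u)) := by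
      intro u hu
      obtain ⟨i, hi⟩ : ∃ i, u i = false := by
        by_contra! hi
        exact hu (funext fun i => by simpa using hi i)
      obtain ⟨q, hq, e⟩ := hq' i
      have hm : IsMorph fun (x : DCube (m + 1)) (j : Fin m) => (x ⊓ u) (i.succAbove j) :=
        (IsMorph.reindex _).comp (IsMorph.inf u)
      refine ⟨_, (cubeOn_iff.2 hq).comp hm, fun w => ?_⟩
      have hwu : lowerFace i (fun j => (w ⊓ u) (i.succAbove j)) = w ⊓ u := by
        funext j
        refine Fin.succAboveCases i ?_ (fun j => ?_) j
        · simp [lowerFace, hi]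
        · simp [lowerFace]
      rw [hh _ fun h' => by simpa [oneV, hi] using congrFun h' i]
      refine (congrFun e _).symm.trans (congrArg q' (Subtype.ext hwu))
    have : Nonempty X := ⟨h ⊤⟩
    obtain ⟨g, hg, hgh⟩ := exists_cubeOn_forall (C := C) (Q := fun u y => u ≠ ⊤ → f y = f (h u)) (by
      intro u g hg
      by_cases hut : u = ⊤
      · obtain ⟨g', h1, h2⟩ := exists_cubeOn_of_lt hC u fun w hw => (hg w hw).1
        exact ⟨g', h1, h2, fun h => absurd hut h⟩
      obtain ⟨p, hp, hph⟩ := hp u hut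
      have hlt : ∀ w < u, f (g w) = f (p w) := by
        intro w hw
        rw [(hg w hw).2 (ne_top_of_lt hw), hph, inf_eq_left.2 hw.le]
      by_cases hk : weight u ≤ k + 1
      · have h1 := CubeOn.congr_rel_of_weight hC hk hp (q' := Function.update g u (h u)) (by
          intro w hw
          rw [← hfr]
          rcases hw.lt_or_eq with hw' | rfl
          · rw [Function.update_of_ne hw'.ne, hlt w hw']
          · simp [hph])
        refine ⟨_, h1, fun w hw => ?_, fun _ => by simp⟩
        rw [inf_eq_left.2 hw.le, Function.update_of_ne hw.ne]
      · obtain ⟨g', h1, h2⟩ := exists_cubeOn_of_lt hC u fun w hw => (hg w hw).1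
        refine ⟨g', h1, h2, fun _ => ?_⟩
        have h3 := eq_of_agree_lt hu (h1.image hf) (hp.image hf) (v := u) (by omega) fun w hw => by
          rw [h2 w hw, hlt w hw]
        rw [h3, hph, inf_idem])
    refine ⟨fun v => f (g v), cubeOn_iff.1 (hg.image hf), fun x => ?_⟩
    exact (hgh _ x.2).trans (hh _ x.2)

end Cubespace
end Nilspace

namespace Nilspace

/-! ### Cubes of `𝓓_k(Z)` -/

section DegCubes

variable {Z : Type w} [AddCommGroup Z] {k n : ℕ}

theorem faceElt_mem_degCubes {I : Finset (Fin n)} (hI : I.card ≤ k) (x : DCube n) (g : Z) :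
    faceElt I x g ∈ degCubes Z k n :=
  AddSubgroup.subset_closure ⟨I, x, g, by simp [degFiltration, hI], rfl⟩

@[simp] theorem faceElt_zero (I : Finset (Fin n)) (x : DCube n) : faceElt I x (0 : Z) = 0 := by
  funext y
  simp [faceElt]

theorem degCubes_induction {p : (DCube n → Z) → Prop}
    (face : ∀ (I : Finset (Fin n)) x g, I.card ≤ k → p (faceElt I x g)) (zero : p 0)
    (add : ∀ a b, p a → p b → p (a + b)) (neg : ∀ a, p a → p (-a)) {d : DCube n → Z}
    (hd : d ∈ degCubes Z k n) : p d := by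
  induction hd using AddSubgroup.closure_induction with
  | mem c hc =>
    obtain ⟨I, x, g, hg, rfl⟩ := hc
    by_cases hI : I.card ≤ k
    · exact face I x g hI
    · simp only [degFiltration, if_neg hI, AddSubgroup.mem_bot] at hg
      rw [hg, faceElt_zero]
      exact zero
  | zero => exact zero
  | add a b _ _ ha hb => exact add a b ha hb
  | neg a _ ha => exact neg a ha

/-- The sign `(-1)^|w|` of a vertex. -/
def vertexSign (w : DCube n) : ℤ := ∏ i, if w i = true then -1 else 1

theorem vertexSign_update (w : DCube n) (i : Fin n) :
    vertexSign (Function.update w i (!w i)) = -vertexSign w := by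
  unfold vertexSign
  rw [← Finset.mul_prod_erase _ _ (Finset.mem_univ i), ← Finset.mul_prod_erase _ _ (Finset.mem_univ i),
    Finset.prod_congr rfl (g := fun j => if w j = true then (-1 : ℤ) else 1) fun j hj => by
      rw [Function.update_of_ne (Finset.ne_of_mem_erase hj)]]
  cases w i <;> simp

-- A face of codimension at most `k` leaves free some coordinate in the support of `v`; flipping
-- that coordinate pairs off terms of opposite sign.
open Classical in
theorem sum_vertexSign_smul {d : DCube n → Z} (hd : d ∈ degCubes Z k n) {v : DCube n}
    (hv : k < weight v) : ∑ w with w ≤ v, vertexSign w • d w = 0 := by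
  refine degCubes_induction (p := fun d => ∑ w with w ≤ v, vertexSign w • d w = 0)
    (fun I x g hI => ?_) (by simp) (fun a b ha hb => ?_) (fun a ha => ?_) hd
  · obtain ⟨i, hi, hiI⟩ : ∃ i, v i = true ∧ i ∉ I := by
      by_contra! h
      have : weight v ≤ I.card := Finset.card_le_card fun i hi => h i (by simpa using hi)
      omega
    refine Finset.sum_involution (fun w _ => Function.update w i (!w i)) ?_ ?_ ?_ ?_
    · intro w _
      have : faceElt I x g (Function.update w i (!w i)) = faceElt I x g w := by
        unfold faceElt
        congr 1
        refine propext (forall₂_congr fun j hj => ?_)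
        rw [Function.update_of_ne (by rintro rfl; exact hiI hj)]
      rw [this, vertexSign_update, neg_smul, add_neg_cancel]
    · intro w _ _ h
      have := congrFun h i
      simp at this
    · intro w hw
      simp only [Finset.mem_filter, Finset.mem_univ, true_and] at hw ⊢
      intro j
      by_cases hj : j = i
      · rw [hj, hi]; exact le_top
      · rw [Function.update_of_ne hj]; exact hw j
    · intro w _
      simp
  · simp [smul_add, Finset.sum_add_distrib, ha, hb]
  · simp [ha]

theorem degCubes_eq_zero_of_lt {d : DCube n → Z} (hd : d ∈ degCubes Z k n) {v : DCube n}
    (hv : k < weight v) (h : ∀ w < v, d w = 0) : d v = 0 := by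
  have h1 := sum_vertexSign_smul hd hv
  rw [Finset.sum_eq_single v (fun w hw hne => by
    simp only [Finset.mem_filter, Finset.mem_univ, true_and] at hw
    rw [h w (hw.lt_of_ne hne), smul_zero]) (fun h => by simp at h)] at h1
  have hs : vertexSign v = 1 ∨ vertexSign v = -1 := by
    refine Finset.prod_induction _ (fun a : ℤ => a = 1 ∨ a = -1) ?_ (Or.inl rfl) ?_
    · rintro a b (rfl | rfl) (rfl | rfl) <;> simp
    · intro i _
      split_ifs <;> simp
  rcases hs with hs | hs <;> simpa [hs] using h1

theorem degCubes_eq_zero {d : DCube n → Z} (hd : d ∈ degCubes Z k n)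
    (h : ∀ v, weight v ≤ k → d v = 0) : d = 0 := by
  funext v
  induction v using WellFoundedLT.induction with
  | ind v ih =>
    by_cases hv : weight v ≤ k
    · exact h v hv
    · exact degCubes_eq_zero_of_lt hd (by omega) ih

/-- Any function agrees with a cube of `𝓓_k(Z)` at the vertices of weight at most `k`. -/
theorem exists_mem_degCubes (k : ℕ) (f : DCube n → Z) :
    ∃ d ∈ degCubes Z k n, ∀ v, weight v ≤ k → d v = f v := by
  have key : ∀ j ≤ k + 1, ∃ d ∈ degCubes Z k n, ∀ v, weight v < j → d v = f v := by
    intro j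
    induction j with
    | zero => exact fun _ => ⟨0, zero_mem _, fun v hv => absurd hv (by simp)⟩
    | succ j ih =>
      intro hj
      obtain ⟨d, hd, h⟩ := ih (by omega)
      -- The defect at the vertex with support `S`. Added on the upward face over `S` with `|S| =
      -- j`, it leaves weights below `j` alone and corrects exactly one vertex of weight `j`.
      let c : Finset (Fin n) → Z := fun S => f (fun i => decide (i ∈ S)) - d fun i => decide (i ∈ S)
      refine ⟨d + ∑ S ∈ Finset.powersetCard j Finset.univ, faceElt S (fun _ => true) (c S),
        add_mem hd (sum_mem fun S hS => faceElt_mem_degCubes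
          (by rw [(Finset.mem_powersetCard.1 hS).2]; omega) _ _), fun v hv => ?_⟩
      have hsub : ∀ S ∈ Finset.powersetCard j (Finset.univ : Finset (Fin n)),
          (∀ i ∈ S, v i = true) → S = Finset.univ.filter fun i => v i = true := by
        intro S hS hSv
        refine Finset.eq_of_subset_of_card_le (fun i hi => by simpa using hSv i hi) ?_
        rw [(Finset.mem_powersetCard.1 hS).2]
        exact Nat.lt_succ_iff.1 hv
      simp only [Pi.add_apply, Finset.sum_apply]
      rcases Nat.lt_succ_iff_lt_or_eq.1 hv with hv | hv
      · rw [Finset.sum_eq_zero, add_zero, h v hv]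
        intro S hS
        refine if_neg fun hSv => ?_
        have h1 := (Finset.mem_powersetCard.1 hS).2
        rw [hsub S hS hSv] at h1
        exact hv.ne h1
      · rw [Finset.sum_eq_single (Finset.univ.filter fun i => v i = true)]
        · have : (fun i => decide (i ∈ Finset.univ.filter fun i => v i = true)) = v := by
            funext i
            cases hvi : v i <;> simp [hvi]
          rw [faceElt, if_pos (by simp)]
          simp only [c]
          rw [this]
          abel
        · intro S hS hne
          exact if_neg fun hSv => hne (hsub S hS hSv)
        · intro h1
          exact absurd (Finset.mem_powersetCard.2 ⟨Finset.subset_univ _, hv⟩) h1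
  obtain ⟨d, hd, h⟩ := key (k + 1) le_rfl
  exact ⟨d, hd, fun v hv => h v (Nat.lt_succ_iff.2 hv)⟩

theorem mem_degCubes_of_le (hn : n ≤ k) (f : DCube n → Z) : f ∈ degCubes Z k n := by
  obtain ⟨d, hd, h⟩ := exists_mem_degCubes k f
  convert hd
  funext v
  refine (h v ((Finset.card_le_univ _).trans ?_)).symm
  simpa using hn

theorem comp_lowerFace_mem_degCubes {d : DCube (n + 1) → Z} (hd : d ∈ degCubes Z k (n + 1))
    (j : Fin (n + 1)) : (fun v => d (lowerFace j v)) ∈ degCubes Z k n := by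
  refine degCubes_induction (p := fun d => (fun v => d (lowerFace j v)) ∈ degCubes Z k n)
    (fun I x g hI => ?_) (zero_mem _) (fun a b ha hb => add_mem ha hb)
    (fun a ha => neg_mem ha) hd
  · by_cases hj : j ∈ I ∧ x j = true
    · convert zero_mem (degCubes Z k n) using 1
      funext v
      refine if_neg fun h => ?_
      have := h j hj.1
      simp [lowerFace, hj.2] at this
    · have hI' : (I.preimage j.succAbove (Fin.succAbove_right_injective.injOn)).card ≤ k :=
        (Finset.card_le_card_of_injOn j.succAbove (fun i hi => by simpa using hi)
          Fin.succAbove_right_injective.injOn).trans hI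
      convert faceElt_mem_degCubes hI' (fun i => x (j.succAbove i)) g using 1
      funext v
      unfold faceElt
      congr 1
      refine propext ⟨fun h i hi => ?_, fun h i => ?_⟩
      · simpa [lowerFace] using h _ (Finset.mem_preimage.1 hi)
      · refine Fin.succAboveCases j (fun hi => ?_) (fun i hi => ?_) i
        · have : x j = false := by simpa [hi] using hj
          simp [lowerFace, this]
        · simpa [lowerFace] using h i (Finset.mem_preimage.2 hi)

theorem weight_lowerFace (j : Fin (n + 1)) (v : DCube n) : weight (lowerFace j v) = weight v := by
  unfold weight
  rw [Finset.card_filter, Finset.card_filter, Fin.sum_univ_succAbove _ j]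
  simp only [lowerFace, Fin.insertNth_apply_same, Fin.insertNth_apply_succAbove]
  simp

/-- Completion of corners in `𝓓_k(Z)`. -/
theorem exists_mem_degCubes_of_corner {f : DCube (n + 1) → Z}
    (hf : ∀ j, (fun v => f (lowerFace j v)) ∈ degCubes Z k n) :
    ∃ d ∈ degCubes Z k (n + 1), ∀ v, v ≠ ⊤ → d v = f v := by
  obtain ⟨d, hd, h⟩ := exists_mem_degCubes k f
  -- Interpolation at low weights suffices: on each lower face both functions are cubes of `𝓓_k(Z)`,
  -- and those are determined by low weights.
  refine ⟨d, hd, fun v hv => ?_⟩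
  obtain ⟨i, hi⟩ : ∃ i, v i = false := by
    by_contra! hi
    exact hv (funext fun i => by simpa using hi i)
  have h1 := degCubes_eq_zero (sub_mem (comp_lowerFace_mem_degCubes hd i) (hf i)) fun w hw =>
    sub_eq_zero.2 (h _ (by rwa [weight_lowerFace]))
  have h2 : lowerFace i (fun j => v (i.succAbove j)) = v := by
    funext j
    refine Fin.succAboveCases i ?_ (fun j => ?_) j
    · simp [lowerFace, hi]
    · simp [lowerFace]
  have h3 := congrFun h1 fun j => v (i.succAbove j)
  simp only [Pi.sub_apply, Pi.zero_apply, h2] at h3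
  exact sub_eq_zero.1 h3

end DegCubes

end Nilspace

namespace Nilspace

namespace Cubespace

variable {X : Type u} {ι κ : Type*} {C : Cubespace X} {k : ℕ}

/-! ### Parallelograms -/

theorem cubeOn_cond (hC : C.IsNilspace) (j : ι) (x x' : X) :
    C.CubeOn fun z : ι → Bool => bif z j then x' else x := by
  have : (fun z : DCube 1 => bif z 0 then x' else x) ∈ C.cubes 1 := by rw [hC.ergodic]; trivial
  exact (cubeOn_iff.2 this).comp (φ := fun z _ => z j) fun _ => IsCoord.proj j

variable (C) in
/-- The `(k+1)`-cube with edges `(x, x')` and a single edge `(y, y')` is a cube. -/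
def Para (k : ℕ) (x x' y y' : X) : Prop :=
  C.CubeOn fun z : Fin k ⊕ Unit → Bool =>
    spike (bif z (.inr ()) then y' else y) (bif z (.inr ()) then x' else x) fun i => z (.inl i)

theorem lt_weight_top : k < weight (⊤ : Fin k ⊕ Unit → Bool) := by
  simp [weight]

theorem sum_ne_top {z : Fin k ⊕ Unit → Bool} (h : z < ⊤) (h1 : z (.inr ()) = true) :
    (fun i => z (.inl i)) ≠ (⊤ : Fin k → Bool) := by
  intro h2
  refine h.ne (funext fun i => ?_)
  rcases i with i | ⟨⟩
  · exact congrFun h2 i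
  · exact h1

theorem Para.unique (hC : C.IsStepNilspace k) {x x' y y₁ y₂ : X} (h₁ : C.Para k x x' y y₁)
    (h₂ : C.Para k x x' y y₂) : y₁ = y₂ := by
  have := hC.eq_of_agree_lt h₁ h₂ lt_weight_top fun w hw => by
    cases hw1 : w (.inr ())
    · rfl
    · rw [spike_of_ne (sum_ne_top hw hw1), spike_of_ne (sum_ne_top hw hw1)]
  have h1 : (fun _ => true) = (⊤ : Fin k → Bool) := rfl
  simpa [h1] using this

/-- The prescribed values form a corner: where the last coordinate is `0` it is the cube `h`, and
the other lower faces only see the edge `(x, x')`. -/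
theorem Para.exists (hC : C.IsNilspace) {x y : X} (h : C.Rel (Fin k) x y) (x' : X) :
    ∃ y', C.Para k x x' y y' := by
  obtain ⟨g, hg, hgf⟩ := exists_cubeOn_of_lt hC (f := fun z : Fin k ⊕ Unit → Bool =>
    spike y (bif z (.inr ()) then x' else x) fun i => z (.inl i)) ⊤ (by
      intro u hu
      cases h1 : u (.inr ())
      · simp only [Pi.inf_apply, h1]
        simpa using h.comp ((IsMorph.reindex Sum.inl).comp (IsMorph.inf u))
      · simp only [Pi.inf_apply, h1]
        refine (congrArg C.CubeOn (funext fun z => ?_)).mp (cubeOn_cond hC (.inr ()) x x')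
        rw [spike_of_ne]
        · simp
        · intro h2
          refine sum_ne_top hu h1 (top_le_iff.1 ?_)
          rw [← h2]
          exact fun i => inf_le_right)
  refine ⟨g ⊤, (congrArg C.CubeOn (funext fun z => ?_)).mp hg⟩
  by_cases hz : z = ⊤
  · rw [hz]
    have h1 : (fun _ => true) = (⊤ : Fin k → Bool) := rfl
    simp [h1]
  · rw [hgf z (lt_top_iff_ne_top.2 hz)]
    cases h1 : z (.inr ())
    · rfl
    · rw [spike_of_ne (sum_ne_top (lt_top_iff_ne_top.2 hz) h1),
        spike_of_ne (sum_ne_top (lt_top_iff_ne_top.2 hz) h1)]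

/-- The two cubes are glued along their common face, the one carrying `x` and `y`. -/
theorem Para.trans (hC : C.IsNilspace) {x x' x'' y y' y'' : X} (h : C.Para k x x' y y')
    (h' : C.Para k x x'' y y'') : C.Para k x' x'' y' y'' := by
  have hφ : IsMorph fun z : Unit ⊕ Fin k → Bool =>
      (Sum.elim (fun i => z (.inr i)) fun _ => z (.inl ()) : Fin k ⊕ Unit → Bool) := by
    rintro (i | i) <;> exact IsCoord.proj _
  have hψ : IsMorph fun z : Fin k ⊕ Unit → Bool =>
      (Sum.elim (fun _ => !z (.inr ())) fun i => z (.inl i) : Unit ⊕ Fin k → Bool) := by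
    rintro (i | i)
    · exact (IsCoord.proj _).not
    · exact IsCoord.proj _
  have key := cubeOn_glue hC (ι := Unit) (κ := Fin k)
    (f := fun a b w => spike (bif a () then y' else bif b () then y'' else y)
      (bif a () then x' else bif b () then x'' else x) w) (by
    intro J
    cases hJ : J ()
    · simpa [hJ] using h'.comp hφ
    · simpa [hJ] using h.comp hφ)
  refine (congrArg C.CubeOn (funext fun z => ?_)).mp (key.comp hψ)
  cases z (.inr ()) <;> simp

theorem Para.swap (hC : C.IsNilspace) {x x' y y' : X} (h : C.Para k x x' y y') :
    C.Para k y y' x x' := by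
  have := cubeOn_spike_top hC h (cubeOn_cond hC (.inr ()) x x') fun z hz => spike_of_ne hz _ _
  have h1 : (fun _ => true) = (⊤ : Fin k → Bool) := rfl
  simpa [Para, h1] using this

/-! ### Translations -/

/-- Passes from single edges to whole cubes `g`: on lower faces already known to be cubes, a
completion exists, and the parallelogram over an edge of `g` forces its last value. -/
theorem cubeOn_spike_translate [Finite κ] (hC : C.IsStepNilspace k) {τ : X → X}
    (hτ : ∀ x x', C.Para k x x' (τ x) (τ x')) {g : (κ → Bool) → X} (hg : C.CubeOn g) :
    C.CubeOn fun z : Fin k ⊕ κ → Bool =>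
      spike (τ (g fun j => z (.inr j))) (g fun j => z (.inr j)) fun i => z (.inl i) := by
  classical
  let P : (Fin k ⊕ κ → Bool) → X := fun z =>
    spike (τ (g fun j => z (.inr j))) (g fun j => z (.inr j)) fun i => z (.inl i)
  suffices h : ∀ v, C.CubeOn fun z => P (z ⊓ v) by simpa [P] using h ⊤
  intro v
  have := Fintype.ofFinite κ
  induction v using WellFoundedLT.induction with
  | ind v ih =>
    by_cases hv : (fun i => v (.inl i)) = (⊤ : Fin k → Bool)
    · by_cases hw : ∃ j, v (.inr j) = true
      · obtain ⟨j, hj⟩ := hw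
        obtain ⟨p, hp, hpv⟩ := exists_cubeOn_of_lt hC.toIsNilspace v ih
        let w₀ : κ → Bool := fun i => v (.inr i)
        -- The `(k+1)`-face with top vertex `v` in the `Fin k` directions and the direction `j`.
        let φ : (Fin k ⊕ Unit → Bool) → (Fin k ⊕ κ → Bool) := fun z =>
          Sum.elim (fun i => z (.inl i)) fun i => if i = j then z (.inr ()) else w₀ i
        have hφ : IsMorph φ := by
          rintro (i | i)
          · exact IsCoord.proj _
          · exact IsCoord.ite (i = j) (IsCoord.proj _) (IsCoord.const _)
        have hφv : φ ⊤ = v := by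
          funext i
          rcases i with i | i
          · exact (congrFun hv i).symm
          · by_cases hi : i = j
            · simp [φ, hi, hj]
            · simp [φ, hi, w₀]
        have hφlt : ∀ z, z < ⊤ → φ z < v := by
          intro z hz
          refine lt_of_le_of_ne ?_ fun h => hz.ne ?_
          · rintro (i | i)
            · rw [congrFun hv i]; exact le_top
            · by_cases hi : i = j
              · rw [hi, hj]; exact le_top
              · simp [φ, hi, w₀]
          · funext i
            rcases i with i | ⟨⟩
            · exact (congrFun h (.inl i)).trans (congrFun hv i)
            · simpa [φ, hj] using congrFun h (.inr j)
        have hP : ∀ z, P (φ z) = spike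
            (bif z (.inr ()) then τ (g w₀) else τ (g (Function.update w₀ j false)))
            (bif z (.inr ()) then g w₀ else g (Function.update w₀ j false))
            fun i => z (.inl i) := by
          intro z
          have h2 : (fun i => φ z (.inr i)) = Function.update w₀ j (z (.inr ())) := by
            funext i
            by_cases hi : i = j
            · subst hi; simp [φ]
            · simp [φ, hi]
          have h3 : Function.update w₀ j true = w₀ := by
            rw [← hj]; exact Function.update_eq_self j w₀
          simp only [P, h2]
          cases z (.inr ())
          · rfl
          · rw [h3]; rfl
        have key := hC.eq_of_agree_lt (hp.comp hφ)
          (hτ (g (Function.update w₀ j false)) (g w₀)) lt_weight_top fun z hz => by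
            rw [hpv _ (hφlt z hz), hP]
        have key2 : p v = P v := by
          rw [← hφv, key, hP]
        refine (congrArg C.CubeOn (funext fun z => ?_)).mp (hp.comp (IsMorph.inf v))
        rcases (inf_le_right : z ⊓ v ≤ v).lt_or_eq with h | h
        · exact hpv _ h
        · rw [h, key2]
      · push Not at hw
        have h1 := (hτ (g ⊥) (g ⊥)).comp (φ := fun z : Fin k ⊕ κ → Bool =>
          Sum.elim (fun i => z (.inl i)) fun _ => true) (by
            rintro (i | i)
            · exact IsCoord.proj _
            · exact IsCoord.const _)
        refine (congrArg C.CubeOn (funext fun z => ?_)).mp h1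
        have h2 : (fun j => (z ⊓ v) (.inr j)) = ⊥ := by
          funext j
          simp [hw j]
        have h3 : (fun i => (z ⊓ v) (.inl i)) = fun i => z (.inl i) := by
          funext i
          have := congrFun hv i
          simp only [Pi.top_apply] at this
          simp [this]
        simp only [P]
        rw [h2, h3]
        rfl
    · refine (congrArg C.CubeOn (funext fun z => ?_)).mp
        (hg.comp ((IsMorph.reindex Sum.inr).comp (IsMorph.inf v)))
      simp only [P]
      rw [spike_of_ne]
      intro h
      refine hv (top_le_iff.1 ?_)
      rw [← h]
      exact fun i => inf_le_right

open Classical in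
/-- The function obtained from `q` by applying `τ` on the face `{v : v i = x i for all i ∈ I}`. -/
noncomputable def moveOn {n : ℕ} (τ : X → X) (I : Finset (Fin n)) (x : DCube n)
    (q : DCube n → X) : DCube n → X :=
  fun v => if ∀ i ∈ I, v i = x i then τ (q v) else q v

theorem moveOn_of {n : ℕ} (τ : X → X) {I : Finset (Fin n)} {x : DCube n} (q : DCube n → X)
    {v : DCube n} (h : ∀ i ∈ I, v i = x i) : moveOn τ I x q v = τ (q v) := if_pos h

theorem moveOn_of_not {n : ℕ} (τ : X → X) {I : Finset (Fin n)} {x : DCube n} (q : DCube n → X)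
    {v : DCube n} (h : ¬ ∀ i ∈ I, v i = x i) : moveOn τ I x q v = q v := if_neg h

/-- After a reflection the face is the top face in the coordinates of `I`, so `cubeOn_replace`
applies; the bound on `I.card` lets the `Fin k` spike restrict to these coordinates. -/
theorem moveOn_mem (hC : C.IsStepNilspace k) {τ : X → X}
    (hτ : ∀ x x', C.Para k x x' (τ x) (τ x')) {n : ℕ} {q : DCube n → X} (hq : q ∈ C.cubes n)
    {I : Finset (Fin n)} (hI : I.card ≤ k) (x : DCube n) : moveOn τ I x q ∈ C.cubes n := by
  classical
  let A := {i // i ∈ I}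
  let B := {i // i ∉ I}
  let φ : (A ⊕ B → Bool) → DCube n := fun z i =>
    if h : i ∈ I then !x i ^^ z (.inl ⟨i, h⟩) else z (.inr ⟨i, h⟩)
  let ψ : DCube n → (A ⊕ B → Bool) := fun v =>
    Sum.elim (fun i => !x i.1 ^^ v i.1) fun i => v i.1
  have hφ : IsMorph φ := by
    intro i
    by_cases h : i ∈ I
    · simpa only [φ, dif_pos h] using (IsCoord.proj _).xor _
    · simpa only [φ, dif_neg h] using IsCoord.proj _
  have hψ : IsMorph ψ := by
    rintro (i | i)
    · exact (IsCoord.proj _).xor _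
    · exact IsCoord.proj _
  have hφψ : ∀ v, φ (ψ v) = v := by
    intro v
    funext i
    by_cases h : i ∈ I <;> simp [φ, ψ, h]
  have hq' := (cubeOn_iff.2 hq).comp hφ
  have hg := hq'.comp (φ := fun w : B → Bool => Sum.elim (⊤ : A → Bool) w) (by
    rintro (i | i)
    · exact IsCoord.const _
    · exact IsCoord.proj _)
  have e : A ↪ Fin k := (Function.Embedding.nonempty_of_card_le (by simpa [A] using hI)).some
  have h1 := cubeOn_replace hC.toIsNilspace hq' (h := fun w => τ (q (φ (Sum.elim ⊤ w))))
    (cubeOn_spike_embedding (a := fun w => τ (q (φ (Sum.elim ⊤ w))))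
      (b := fun w => q (φ (Sum.elim ⊤ w))) (cubeOn_spike_translate hC hτ hg) e)
  rw [← cubeOn_iff]
  refine (congrArg C.CubeOn (funext fun v => ?_)).mp (h1.comp hψ)
  have htop : (fun i => ψ v (.inl i)) = (⊤ : A → Bool) ↔ ∀ i ∈ I, v i = x i := by
    rw [funext_iff]
    constructor
    · intro h i hi
      have := h ⟨i, hi⟩
      simp only [ψ, Sum.elim_inl, Pi.top_apply] at this
      cases hv : v i <;> cases hx : x i <;> simp_all
    · rintro h ⟨i, hi⟩
      simp [ψ, h i hi]
  unfold moveOn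
  by_cases h : ∀ i ∈ I, v i = x i
  · rw [if_pos h, htop.2 h, spike_top]
    congr 2
    rw [← htop.2 h]
    refine Eq.trans (congrArg φ ?_) (hφψ v)
    funext i
    cases i <;> rfl
  · rw [if_neg h, spike_of_ne (fun h' => h (htop.1 h')), hφψ]

variable (C) in
/-- The group of translations of height `k`: the bijections that preserve cubes when applied on a
face of codimension at most `k`. -/
def translationGroup (k : ℕ) : Subgroup (Equiv.Perm X) where
  carrier := {τ | ∀ (n : ℕ) (q : DCube n → X) (I : Finset (Fin n)) (x : DCube n), I.card ≤ k →
    (moveOn τ I x q ∈ C.cubes n ↔ q ∈ C.cubes n)}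
  one_mem' n q I x _ := by
    refine Iff.of_eq (congrArg (· ∈ C.cubes n) (funext fun v => ?_))
    by_cases h : ∀ i ∈ I, v i = x i
    · rw [moveOn_of _ _ h, Equiv.Perm.one_apply]
    · rw [moveOn_of_not _ _ h]
  mul_mem' {σ τ} hσ hτ n q I x hI := by
    rw [← hτ n q I x hI, ← hσ n (moveOn τ I x q) I x hI]
    refine Iff.of_eq (congrArg (· ∈ C.cubes n) (funext fun v => ?_))
    by_cases h : ∀ i ∈ I, v i = x i
    · rw [moveOn_of _ _ h, moveOn_of _ _ h, moveOn_of _ _ h, Equiv.Perm.mul_apply]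
    · rw [moveOn_of_not _ _ h, moveOn_of_not _ _ h, moveOn_of_not _ _ h]
  inv_mem' {τ} hτ n q I x hI := by
    rw [← hτ n _ I x hI]
    refine Iff.of_eq (congrArg (· ∈ C.cubes n) (funext fun v => ?_))
    by_cases h : ∀ i ∈ I, v i = x i
    · rw [moveOn_of _ _ h, moveOn_of _ _ h]
      exact τ.apply_symm_apply (q v)
    · rw [moveOn_of_not _ _ h, moveOn_of_not _ _ h]

/-- The translation sends `x'` to the fourth vertex of the parallelogram on `x, x', y`; starting
from the pair `(y, x)` gives its inverse. -/
theorem exists_translation (hC : C.IsStepNilspace k) {x y : X} (h : C.Rel (Fin k) x y) :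
    ∃ τ ∈ C.translationGroup k, τ x = y := by
  choose f hf using fun x' => Para.exists hC.toIsNilspace h x'
  choose g hg using fun y' => Para.exists hC.toIsNilspace (h.symm hC.toIsNilspace) y'
  have hff : ∀ a b, C.Para k a b (f a) (f b) := fun a b => (hf a).trans hC.toIsNilspace (hf b)
  have hgg : ∀ a b, C.Para k a b (g a) (g b) := fun a b => (hg a).trans hC.toIsNilspace (hg b)
  have hgf : Function.LeftInverse g f := fun a => (hg (f a)).unique hC ((hf a).swap hC.toIsNilspace)
  have hfg : Function.RightInverse g f := fun a =>
    (hf (g a)).unique hC ((hg a).swap hC.toIsNilspace)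
  refine ⟨⟨f, g, hgf, hfg⟩, fun n q I a hI => ⟨fun hq => ?_, fun hq => moveOn_mem hC hff hq hI a⟩, ?_⟩
  · convert moveOn_mem hC hgg hq hI a
    funext v
    by_cases h : ∀ i ∈ I, v i = a i
    · rw [moveOn_of _ _ h, moveOn_of _ _ h]
      exact (hgf (q v)).symm
    · rw [moveOn_of_not _ _ h, moveOn_of_not _ _ h]
  · refine (hf x).unique hC ?_
    simpa [Para] using h.comp (IsMorph.reindex (Sum.inl : Fin k → Fin k ⊕ Unit))

/-- Apply `σ` and `τ`, in either order, to a constant `(k+2)`-cube along two different edges at `⊤`.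
The edges meet only at `⊤`, so the results agree elsewhere, hence also at `⊤`. -/
theorem translation_mul_comm (hC : C.IsStepNilspace (k + 1)) {σ τ : Equiv.Perm X}
    (hσ : σ ∈ C.translationGroup (k + 1)) (hτ : τ ∈ C.translationGroup (k + 1)) :
    σ * τ = τ * σ := by
  ext x
  have hcard : ∀ i : Fin (k + 2), (Finset.univ.erase i).card ≤ k + 1 := by simp
  have hm : ∀ ρ ∈ C.translationGroup (k + 1), ∀ (i : Fin (k + 2)) (q : DCube (k + 2) → X),
      C.CubeOn q → C.CubeOn (moveOn ρ (Finset.univ.erase i) ⊤ q) := fun ρ hρ i q hq =>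
    cubeOn_iff.2 ((hρ _ _ _ _ (hcard i)).2 (cubeOn_iff.1 hq))
  have h1 := hm σ hσ 0 _ (hm τ hτ (Fin.last _) _ (cubeOn_const x))
  have h2 := hm τ hτ (Fin.last _) _ (hm σ hσ 0 _ (cubeOn_const x))
  have := hC.eq_top h1 h2 fun c hc => by
    have hc' : ¬ ((∀ i ∈ Finset.univ.erase (0 : Fin (k + 2)), c i = (⊤ : DCube (k + 2)) i) ∧
        ∀ i ∈ Finset.univ.erase (Fin.last (k + 1)), c i = (⊤ : DCube (k + 2)) i) := by
      rintro ⟨ha, hb⟩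
      refine hc (funext fun i => ?_)
      by_cases hi : i = 0
      · refine hb i (Finset.mem_erase.2 ⟨?_, Finset.mem_univ _⟩)
        rw [hi]
        exact (Fin.last_pos).ne
      · exact ha i (Finset.mem_erase.2 ⟨hi, Finset.mem_univ _⟩)
    unfold moveOn
    by_cases ha : ∀ i ∈ Finset.univ.erase (0 : Fin (k + 2)), c i = (⊤ : DCube (k + 2)) i
    · have hb := fun hb => hc' ⟨ha, hb⟩
      simp only [if_pos ha, if_neg hb]
    · simp only [if_neg ha]
  simpa [moveOn] using this

/-- On the `(k+1)`-cube that equals `x` or `x'` according to coordinate `0`, apply `τ` along the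
edge at `⊤` in that direction. The lower endpoint is fixed, so only `⊤` could change, and uniqueness
forbids that. -/
theorem translation_eq_one (hC : C.IsStepNilspace k) {τ : Equiv.Perm X}
    (hτ : τ ∈ C.translationGroup k) {x : X} (h : τ x = x) : τ = 1 := by
  ext x'
  let I : Finset (Fin (k + 1)) := Finset.univ.erase 0
  have hq := cubeOn_cond hC.toIsNilspace (0 : Fin (k + 1)) x x'
  have h1 := (hτ _ _ I ⊤ (by simp [I])).2 (cubeOn_iff.1 hq)
  have := hC.eq_top (cubeOn_iff.2 h1) hq fun c hc => by
    unfold moveOn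
    split_ifs with hI
    · cases h0 : c 0
      · simpa [h0] using h
      · refine absurd (funext fun i => ?_) hc
        by_cases hi : i = 0
        · rw [hi, h0]; rfl
        · exact hI i (Finset.mem_erase.2 ⟨hi, Finset.mem_univ _⟩)
    · rfl
  simpa [moveOn] using this

theorem vadd_mem_iff_mem_degCubes (hC : C.IsStepNilspace k) {Z : Type w} [AddCommGroup Z]
    [AddAction Z X] (hfree : ∀ (z : Z) (x : X), z +ᵥ x = x → z = 0)
    (hface : ∀ (z : Z) (n : ℕ) (q : DCube n → X) (I : Finset (Fin n)) (x : DCube n), I.card ≤ k →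
      q ∈ C.cubes n → (fun v => faceElt I x z v +ᵥ q v) ∈ C.cubes n)
    {n : ℕ} {q : DCube n → X} (hq : q ∈ C.cubes n) (d : DCube n → Z) :
    (fun v => d v +ᵥ q v) ∈ C.cubes n ↔ d ∈ degCubes Z k n := by
  have hmem : ∀ d ∈ degCubes Z k n, ∀ q : DCube n → X,
      (fun v => d v +ᵥ q v) ∈ C.cubes n ↔ q ∈ C.cubes n := by
    intro d hd
    refine degCubes_induction (p := fun d => ∀ q : DCube n → X,
      (fun v => d v +ᵥ q v) ∈ C.cubes n ↔ q ∈ C.cubes n) ?_ ?_ ?_ ?_ hd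
    · refine fun I x z hI q => ⟨fun h => ?_, hface z n q I x hI⟩
      have h1 := hface (-z) n _ I x hI h
      convert h1 using 1
      funext v
      by_cases hv : ∀ i ∈ I, v i = x i
      · simp only [faceElt, if_pos hv, neg_vadd_vadd]
      · simp only [faceElt, if_neg hv, zero_vadd]
    · simp
    · intro a b ha hb q
      simp only [Pi.add_apply, add_vadd]
      rw [ha, hb]
    · intro a ha q
      rw [← ha]
      simp
  refine ⟨fun h => ?_, fun h => (hmem d h q).2 hq⟩
  -- The translates by `d` and `d'` are cubes agreeing at weights at most `k`, hence equal; freeness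
  -- gives `d = d'`.
  obtain ⟨d', hd', h'⟩ := exists_mem_degCubes k d
  convert hd'
  funext v
  have key : d v +ᵥ q v = d' v +ᵥ q v := by
    induction v using WellFoundedLT.induction with
    | ind v ih =>
      by_cases hv : weight v ≤ k
      · rw [h' v hv]
      · exact hC.eq_of_agree_lt (cubeOn_iff.2 h) (cubeOn_iff.2 ((hmem d' hd' q).2 hq))
          (by omega) ih
  rw [← sub_eq_zero]
  refine hfree _ (d' v +ᵥ q v) ?_
  rw [← add_vadd, sub_add_cancel, key]

/-- The structure group of the fibration of a `(k+1)`-step nilspace over its `k`-step factor. -/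
theorem IsStepNilspace.exists_structureGroup (hC : C.IsStepNilspace (k + 1)) :
    ∃ (Z : Type u) (_ : AddCommGroup Z) (_ : AddAction Z X),
      (∀ (z : Z) (x : X), z +ᵥ x = x → z = 0) ∧
      (∀ x y : X, C.Rel (Fin (k + 1)) x y ↔ ∃ z : Z, z +ᵥ x = y) ∧
      ∀ (n : ℕ) (q : DCube n → X), q ∈ C.cubes n → ∀ d : DCube n → Z,
        (fun v => d v +ᵥ q v) ∈ C.cubes n ↔ d ∈ degCubes Z (k + 1) n := by
  let _ : CommGroup (C.translationGroup (k + 1)) :=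
    { (inferInstance : Group (C.translationGroup (k + 1))) with
      mul_comm := fun σ τ => Subtype.ext (translation_mul_comm hC σ.2 τ.2) }
  have hfree : ∀ (z : Additive (C.translationGroup (k + 1))) (x : X), z +ᵥ x = x → z = 0 :=
    fun z x h => congrArg Additive.ofMul
      (Subtype.ext (translation_eq_one hC (Additive.toMul z).2 h) : Additive.toMul z = 1)
  refine ⟨Additive (C.translationGroup (k + 1)), inferInstance, inferInstance, hfree, ?_, ?_⟩
  · refine fun x y => ⟨fun h => ?_, ?_⟩
    · obtain ⟨τ, hτ, h⟩ := exists_translation hC h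
      exact ⟨Additive.ofMul ⟨τ, hτ⟩, h⟩
    · rintro ⟨z, rfl⟩
      have h1 := ((Additive.toMul z).2 (k + 1) (fun _ => x) Finset.univ ⊤ (by simp)).2
        (cubeOn_iff.1 (cubeOn_const x))
      refine (congrArg C.CubeOn (funext fun c => ?_)).mp (cubeOn_iff.2 h1)
      by_cases hc : c = ⊤
      · rw [hc, moveOn_of _ _ fun _ _ => rfl, spike_top]
        rfl
      · rw [spike_of_ne hc, moveOn_of_not _ _ fun h => hc (funext fun i => h i (Finset.mem_univ i))]
  · intro n q hq d
    refine vadd_mem_iff_mem_degCubes hC hfree (fun z n q I x hI hq => ?_) hq d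
    refine (congrArg (· ∈ C.cubes n) (funext fun v => ?_)).mp
      (((Additive.toMul z).2 n q I x hI).2 hq)
    by_cases hv : ∀ i ∈ I, v i = x i
    · simp only [moveOn, faceElt, if_pos hv]
      rfl
    · simp only [moveOn, faceElt, if_neg hv]
      exact (zero_vadd _ _).symm

end Cubespace
end Nilspace

namespace Nilspace

/-! ### Abelian bundles -/

section Bundle

variable {Z : Type w} [AddCommGroup Z] {B : Type u} {S : Type v} [AddAction Z B] {π : B → S}

theorem IsAbelianBundle.eq_zero (h : IsAbelianBundle Z π) {z : Z} {x : B} (hz : z +ᵥ x = x) :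
    z = 0 := by
  have : z ∈ {z : Z | z +ᵥ x = x} := hz
  rwa [h.free x] at this

theorem IsAbelianBundle.vadd_injective (h : IsAbelianBundle Z π) {z z' : Z} {x : B}
    (hz : z +ᵥ x = z' +ᵥ x) : z = z' := by
  rw [← sub_eq_zero]
  refine h.eq_zero (x := z' +ᵥ x) ?_
  rw [← add_vadd, sub_add_cancel, hz]

theorem IsAbelianBundle.proj_eq_iff (h : IsAbelianBundle Z π) {x y : B} :
    π x = π y ↔ ∃ z : Z, z +ᵥ x = y := by
  have key : π ⁻¹' {π x} = AddAction.orbit Z x := by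
    obtain ⟨x', hx'⟩ := h.bijOn.mapsTo (Set.mem_univ (π x))
    have hx' : AddAction.orbit Z x' = π ⁻¹' {π x} := hx'
    have hm : x ∈ AddAction.orbit Z x' := by rw [hx']; rfl
    rw [← hx', AddAction.orbit_eq_iff.2 hm]
  have h1 : y ∈ π ⁻¹' {π x} ↔ y ∈ AddAction.orbit Z x := by rw [key]
  rw [Set.mem_preimage, Set.mem_singleton_iff, eq_comm] at h1
  exact h1

theorem isAbelianBundle_of (hπ : Function.Surjective π)
    (hfree : ∀ (z : Z) (x : B), z +ᵥ x = x → z = 0)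
    (horb : ∀ x y : B, π x = π y ↔ ∃ z : Z, z +ᵥ x = y) : IsAbelianBundle Z π := by
  have key : ∀ x, π ⁻¹' {π x} = AddAction.orbit Z x := fun x => Set.ext fun y =>
    (eq_comm : π y = π x ↔ π x = π y).trans (horb x y)
  refine ⟨fun x => Set.eq_singleton_iff_unique_mem.2 ⟨zero_vadd _ _, fun z hz => hfree z x hz⟩,
    fun s _ => ?_, fun s _ t _ hst => ?_, ?_⟩
  · obtain ⟨x, rfl⟩ := hπ s
    exact ⟨x, (key x).symm⟩
  · obtain ⟨x, rfl⟩ := hπ s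
    have : x ∈ π ⁻¹' {t} := by
      rw [← show π ⁻¹' {π x} = π ⁻¹' {t} from hst]
      rfl
    exact this
  · rintro _ ⟨x, rfl⟩
    exact ⟨π x, Set.mem_univ _, key x⟩

end Bundle

/-! ### Extending a nilspace by one abelian bundle. -/

namespace Cubespace

section Step

variable {B : Type u} {S : Type v} {Z : Type w} [AddCommGroup Z] [AddAction Z B] {π : B → S}
  {C : Cubespace B} {D : Cubespace S} {s : ℕ}

/-- In small dimensions, the cubes of an extension are the lifts of the cubes of the base. -/
theorem mem_cubes_of_proj_mem (hπ : IsAbelianBundle Z π)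
    (hD : ∀ n (p : DCube n → S), p ∈ D.cubes n → ∃ q ∈ C.cubes n, p = π ∘ q)
    (hdeg : ∀ n, ∀ q ∈ C.cubes n, {q₂ | q₂ ∈ C.cubes n ∧ π ∘ q = π ∘ q₂} =
      {q₂ | ∃ q₃ ∈ degCubes Z (s + 1) n, q₂ = fun a => q₃ a +ᵥ q a})
    {n : ℕ} (hn : n ≤ s + 1) {p : DCube n → B} (hp : π ∘ p ∈ D.cubes n) : p ∈ C.cubes n := by
  obtain ⟨q, hq, h⟩ := hD n _ hp
  choose d hd using fun v => hπ.proj_eq_iff.1 (congrFun h v).symm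
  have : p ∈ {q₂ | ∃ q₃ ∈ degCubes Z (s + 1) n, q₂ = fun a => q₃ a +ᵥ q a} :=
    ⟨d, mem_degCubes_of_le hn d, funext fun v => (hd v).symm⟩
  rw [← hdeg n q hq] at this
  exact this.1

theorem IsStepNilspace.of_bundle (hπ : IsAbelianBundle Z π)
    (hD : ∀ n (p : DCube n → S), p ∈ D.cubes n ↔ ∃ q ∈ C.cubes n, p = π ∘ q)
    (hdeg : ∀ n, ∀ q ∈ C.cubes n, {q₂ | q₂ ∈ C.cubes n ∧ π ∘ q = π ∘ q₂} =
      {q₂ | ∃ q₃ ∈ degCubes Z (s + 1) n, q₂ = fun a => q₃ a +ᵥ q a})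
    (h : D.IsStepNilspace s) : C.IsStepNilspace (s + 1) := by
  classical
  refine IsStepNilspace.of_unique ⟨?_, fun m q' hq' => ?_⟩ fun q₀ q₁ h₀ h₁ hq => ?_
  · refine Set.eq_univ_of_forall fun p => ?_
    refine mem_cubes_of_proj_mem hπ (fun n p => (hD n p).1) hdeg (by omega) ?_
    rw [h.ergodic]
    trivial
  · obtain ⟨p, hp, hpq⟩ := h.completion m (fun x => π (q' x)) fun i => (hD _ _).2 ⟨_, hq' i, rfl⟩
    obtain ⟨q, hq, rfl⟩ := (hD _ _).1 hp
    have hd : ∀ v : DCube (m + 1), ∃ z : Z, ∀ hv : v ≠ oneV (m + 1), z +ᵥ q v = q' ⟨v, hv⟩ := by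
      intro v
      by_cases hv : v = oneV (m + 1)
      · exact ⟨0, fun hv' => absurd hv hv'⟩
      · obtain ⟨z, hz⟩ := hπ.proj_eq_iff.1 (hpq ⟨v, hv⟩)
        exact ⟨z, fun _ => hz⟩
    choose d hd using hd
    -- On each lower face `q` and `q'` are cubes over the same base cube, so their difference `d` is
    -- a corner of `𝓓_(s+1)(Z)`.
    obtain ⟨d', hd', hdd⟩ := exists_mem_degCubes_of_corner (k := s + 1) (f := d) (by
      intro j
      have hqj := cubeOn_iff.1 ((cubeOn_iff.2 hq).comp (isMorph_lowerFace j))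
      have : (fun x => q' ⟨lowerFace j x, lowerFace_ne_oneV j x⟩) ∈
          {q₂ | q₂ ∈ C.cubes m ∧ π ∘ (fun x => q (lowerFace j x)) = π ∘ q₂} :=
        ⟨hq' j, funext fun x => hpq ⟨_, lowerFace_ne_oneV j x⟩⟩
      rw [hdeg m _ hqj] at this
      obtain ⟨d₃, hd₃, e⟩ := this
      convert hd₃
      rename_i v
      exact hπ.vadd_injective ((hd _ (lowerFace_ne_oneV j v)).trans (congrFun e v)))
    have : (fun v => d' v +ᵥ q v) ∈
        {q₂ | ∃ q₃ ∈ degCubes Z (s + 1) (m + 1), q₂ = fun a => q₃ a +ᵥ q a} := ⟨d', hd', rfl⟩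
    rw [← hdeg _ q hq] at this
    exact ⟨_, this.1, fun x => by rw [hdd _ x.2, hd _ x.2]⟩
  · have hw : s + 1 < weight (⊤ : DCube (s + 1 + 1)) := by simp [weight]
    -- Uniqueness in the base makes the two completions differ by a cube of `𝓓_(s+1)(Z)`; it
    -- vanishes off `⊤`, hence also at `⊤`, whose weight is `s+2`.
    have h1 : ∀ c, π (q₀ c) = π (q₁ c) := by
      intro c
      by_cases hc : c = ⊤
      · rw [hc]
        exact h.eq_of_agree_lt (q₀ := fun c => π (q₀ c)) (q₁ := fun c => π (q₁ c))
          (cubeOn_iff.2 ((hD _ _).2 ⟨_, cubeOn_iff.1 h₀, rfl⟩))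
          (cubeOn_iff.2 ((hD _ _).2 ⟨_, cubeOn_iff.1 h₁, rfl⟩))
          (by omega) fun w hw => by rw [hq w hw.ne]
      · rw [hq c hc]
    have : q₁ ∈ {q₂ | q₂ ∈ C.cubes (s + 1 + 1) ∧ π ∘ q₀ = π ∘ q₂} :=
      ⟨cubeOn_iff.1 h₁, funext h1⟩
    rw [hdeg _ q₀ (cubeOn_iff.1 h₀)] at this
    obtain ⟨d, hd, rfl⟩ := this
    have h2 := degCubes_eq_zero_of_lt hd hw fun w hw => hπ.eq_zero (hq w hw.ne).symm
    simp only [h2, zero_vadd]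

end Step

variable {X : Type u} {Y : Type v} {C : Cubespace X} {k : ℕ}

theorem mem_cubes_of_injective {f : X → Y} {hf : Function.Surjective f} (hi : Function.Injective f)
    {n : ℕ} {q : DCube n → X} (hq : f ∘ q ∈ (C.image f hf).cubes n) : q ∈ C.cubes n := by
  obtain ⟨q', hq', h⟩ := hq
  rwa [hi.comp_left h]

theorem IsStepNilspace.of_image {f : X → Y} {hf : Function.Surjective f}
    (hi : Function.Injective f) (h : (C.image f hf).IsStepNilspace k) : C.IsStepNilspace k := by
  refine IsStepNilspace.of_unique ⟨?_, fun m q' hq' => ?_⟩ fun q₀ q₁ h₀ h₁ hq => ?_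
  · refine Set.eq_univ_of_forall fun p => mem_cubes_of_injective (hf := hf) hi ?_
    rw [h.ergodic]
    trivial
  · obtain ⟨p, hp, hpq⟩ := h.completion m (fun x => f (q' x)) fun i => ⟨_, hq' i, rfl⟩
    obtain ⟨q, hq, rfl⟩ := hp
    exact ⟨q, hq, fun x => hi (hpq x)⟩
  · exact hi (h.eq_top (h₀.image hf) (h₁.image hf) fun c hc => by rw [hq c hc])

end Cubespace

/-! ### Degree-`k` bundles are `k`-step nilspaces with factors `B_i`. -/

namespace KFoldBundle

variable {k : ℕ} {X : Type u} {C : Cubespace X} {E : KFoldBundle.{u, v, w} k X}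

theorem toFactor_last (E : KFoldBundle.{u, v, w} k X) : E.toFactor (Fin.last k) = E.top := by
  simp [toFactor]

theorem toFactor_castSucc (E : KFoldBundle.{u, v, w} k X) (i : Fin k) :
    E.toFactor i.castSucc = E.proj i ∘ E.toFactor i.succ := by
  simp [toFactor]

theorem mem_factorCubespace_castSucc (i : Fin k) (n : ℕ) (p : DCube n → E.factor i.castSucc) :
    p ∈ (E.factorCubespace C i.castSucc).cubes n ↔
      ∃ q ∈ (E.factorCubespace C i.succ).cubes n, p = E.proj i ∘ q := by
  constructor
  · rintro ⟨q, hq, rfl⟩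
    exact ⟨_, ⟨q, hq, rfl⟩, by rw [toFactor_castSucc]; rfl⟩
  · rintro ⟨_, ⟨q, hq, rfl⟩, rfl⟩
    exact ⟨q, hq, by rw [toFactor_castSucc]; rfl⟩

theorem IsDegreeBundle.isStepNilspace_factor (hE : E.IsDegreeBundle C) (i : Fin (k + 1)) :
    (E.factorCubespace C i).IsStepNilspace i.val := by
  induction i using Fin.induction with
  | zero =>
    obtain ⟨b, hb⟩ := E.base
    have hall : ∀ (n : ℕ) (q : DCube n → E.factor 0), q ∈ (E.factorCubespace C 0).cubes n := by
      intro n q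
      rw [← Cubespace.cubeOn_iff, show q = fun _ => b from funext fun _ => hb _]
      exact Cubespace.cubeOn_const b
    refine Cubespace.IsStepNilspace.of_unique ⟨Set.eq_univ_of_forall (hall 1), fun m q' _ => ?_⟩
      fun q₀ q₁ _ _ _ => (hb _).trans (hb _).symm
    exact ⟨fun _ => b, hall _ _, fun _ => (hb _).symm⟩
  | succ i ih =>
    exact Cubespace.IsStepNilspace.of_bundle (E.isBundle i)
      (mem_factorCubespace_castSucc i) (hE i) ih

theorem IsDegreeBundle.isStepNilspace (hE : E.IsDegreeBundle C) : C.IsStepNilspace k := by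
  refine Cubespace.IsStepNilspace.of_image ?_ (hE.isStepNilspace_factor (Fin.last k))
  rw [toFactor_last]
  exact E.top.injective

/-- Every bundle between `B_i` and `X` has degree at least `i+1`, so in dimension at most `i+1` all
lifts of a cube are cubes. -/
theorem IsDegreeBundle.mem_cubes (hE : E.IsDegreeBundle C) (i : Fin (k + 1)) :
    ∀ (n : ℕ) (q : DCube n → X), n ≤ i.val + 1 →
      E.toFactor i ∘ q ∈ (E.factorCubespace C i).cubes n → q ∈ C.cubes n := by
  induction i using Fin.reverseInduction with
  | last =>
    intro n q _ hq
    refine Cubespace.mem_cubes_of_injective ?_ hq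
    rw [toFactor_last]
    exact E.top.injective
  | cast i ih =>
    intro n q hn hq
    refine ih n q (by simp at hn ⊢; omega) ?_
    refine Cubespace.mem_cubes_of_proj_mem (E.isBundle i)
      (fun n p => (mem_factorCubespace_castSucc i n p).1) (hE i) hn ?_
    rw [toFactor_castSucc] at hq
    exact hq

/-- If the projections agree, the spike lies over a constant cube of `B_i` and is therefore a cube.
Conversely, a spike cube projects to a cube that agrees with a constant one off `⊤`, and `B_i` is
`i`-step. -/
theorem IsDegreeBundle.toFactor_eq_iff (hE : E.IsDegreeBundle C) (i : Fin (k + 1)) {x y : X} :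
    E.toFactor i x = E.toFactor i y ↔ C.sim i.val x y := by
  rw [Cubespace.sim_iff_rel hE.isStepNilspace.toIsNilspace]
  constructor
  · intro h
    refine Cubespace.cubeOn_iff.2 (hE.mem_cubes i _ _ le_rfl ?_)
    refine Cubespace.cubeOn_iff.1 ?_
    refine (congrArg _ (funext fun c => ?_)).mp (Cubespace.cubeOn_const (E.toFactor i x))
    rw [Function.comp_apply, apply_spike (E.toFactor i), h, spike_self]
  · intro h
    have := (hE.isStepNilspace_factor i).eq_top (h.image (E.toFactor_surjective i))
      (Cubespace.cubeOn_const (E.toFactor i x)) fun c hc => by rw [spike_of_ne hc]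
    rw [← this, spike_top]

theorem IsDegreeBundle.exists_iso (hE : E.IsDegreeBundle C) (i : Fin (k + 1)) :
    ∃ (h : Equivalence (C.sim i.val)) (φ : Quotient (Setoid.mk (C.sim i.val) h) ≃ E.factor i),
      (∀ x : X, φ (Quotient.mk _ x) = E.toFactor i x) ∧
      (C.quotient (Setoid.mk (C.sim i.val) h)).IsIso (E.factorCubespace C i) φ := by
  have h := Cubespace.sim_equivalence hE.isStepNilspace.toIsNilspace i.val
  let S := Setoid.mk (C.sim i.val) h
  let f : Quotient S → E.factor i :=
    Quotient.lift (E.toFactor i) fun x y hxy => (hE.toFactor_eq_iff i).2 hxy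
  have hf : Function.Bijective f := by
    constructor
    · rintro ⟨x⟩ ⟨y⟩ hxy
      exact Quotient.sound ((hE.toFactor_eq_iff i).1 hxy)
    · intro b
      obtain ⟨x, rfl⟩ := E.toFactor_surjective i b
      exact ⟨Quotient.mk S x, rfl⟩
  refine ⟨h, Equiv.ofBijective f hf, fun _ => rfl, fun n q => ⟨?_, ?_⟩⟩
  · rintro ⟨p, hp, rfl⟩
    exact ⟨p, hp, rfl⟩
  · rintro ⟨p, hp, e⟩
    exact ⟨p, hp, hf.injective.comp_left e⟩

theorem toFactor_eq_of (E : KFoldBundle.{u, v, w} k X) (g : ∀ i, X → E.factor i)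
    (hlast : ∀ x, E.top x = g (Fin.last k) x)
    (hcast : ∀ (i : Fin k) x, E.proj i (g i.succ x) = g i.castSucc x) (i : Fin (k + 1)) :
    E.toFactor i = g i := by
  induction i using Fin.reverseInduction with
  | last => rw [toFactor_last]; exact funext hlast
  | cast i ih => rw [toFactor_castSucc, ih]; exact funext (hcast i)

theorem isDegreeBundle_of (E : KFoldBundle.{u, v, w} k X)
    (h : ∀ (i : Fin k) (n : ℕ), ∀ q ∈ (E.factorCubespace C i.succ).cubes n,
      ∀ d : DCube n → E.grp i, (fun v => d v +ᵥ q v) ∈ (E.factorCubespace C i.succ).cubes n ↔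
        d ∈ degCubes (E.grp i) (i.val + 1) n) : E.IsDegreeBundle C := by
  refine fun i n q hq => Set.ext fun q₂ => ⟨?_, ?_⟩
  · rintro ⟨h₂, e⟩
    choose d hd using fun v => (E.isBundle i).proj_eq_iff.1 (congrFun e v)
    obtain rfl : (fun v => d v +ᵥ q v) = q₂ := funext hd
    exact ⟨d, (h i n q hq d).1 h₂, rfl⟩
  · rintro ⟨d, hd, rfl⟩
    exact ⟨(h i n q hq d).2 hd, funext fun v => (E.isBundle i).proj_eq_iff.2 ⟨d v, rfl⟩⟩

end KFoldBundle

/-! ### The bundle structure on a `k`-step nilspace. -/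

namespace Cubespace

variable {X : Type u} {C : Cubespace X} {k : ℕ}

/-- The setoid of the relation `∼_i` of a nilspace. -/
def IsNilspace.simSetoid (hC : C.IsNilspace) (i : ℕ) : Setoid X :=
  ⟨C.sim i, sim_equivalence hC i⟩

theorem IsNilspace.mk_eq_iff (hC : C.IsNilspace) (i : ℕ) (x y : X) :
    Quotient.mk (hC.simSetoid i) x = Quotient.mk (hC.simSetoid i) y ↔ C.Rel (Fin (i + 1)) x y :=
  Quotient.eq.trans (sim_iff_rel hC)

theorem IsNilspace.isStepNilspace_quotient (hC : C.IsNilspace) (i : ℕ) :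
    (C.quotient (hC.simSetoid i)).IsStepNilspace i :=
  hC.isStepNilspace_image _ (hC.mk_eq_iff i)

/-- The projection from the `(i+1)`-step factor to the `i`-step factor. -/
def IsNilspace.factorProj (hC : C.IsNilspace) (i : ℕ) :
    Quotient (hC.simSetoid (i + 1)) → Quotient (hC.simSetoid i) :=
  Quotient.lift (Quotient.mk _) fun x y h => (hC.mk_eq_iff i x y).2
    (((sim_iff_rel hC).1 h).of_card_le (by simp))

/-- Spike cubes of dimension `i+1` lift from `X/∼_(i+1)` to `X`, since cubes of that dimension do
not notice `∼_(i+1)`. This makes the fibres orbits of the structure group. -/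
theorem IsNilspace.factorProj_eq_iff (hC : C.IsNilspace) (i : ℕ)
    (a b : Quotient (hC.simSetoid (i + 1))) : hC.factorProj i a = hC.factorProj i b ↔
      (C.quotient (hC.simSetoid (i + 1))).Rel (Fin (i + 1)) a b := by
  obtain ⟨x, rfl⟩ := Quotient.mk_surjective a
  obtain ⟨y, rfl⟩ := Quotient.mk_surjective b
  refine (hC.mk_eq_iff i x y).trans ⟨fun h => ?_, fun h => ?_⟩
  · have := h.image (f := Quotient.mk (hC.simSetoid (i + 1))) Quotient.mk_surjective
    exact (congrArg (CubeOn _) (funext fun c => apply_spike _ _ _ _)).mp this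
  · obtain ⟨q, hq, e⟩ := CubeOn.exists_of_image h
    refine hq.congr_rel (n := i + 1 + 1) hC (by simp) fun c => ?_
    rw [← hC.mk_eq_iff, apply_spike (Quotient.mk _), ← e]

theorem IsStepNilspace.exists_isDegreeBundle [Nonempty X] (hC : C.IsStepNilspace k) :
    ∃ E : KFoldBundle.{u, u, u} k X, E.IsDegreeBundle C := by
  have hN := hC.toIsNilspace
  choose Z hZ hact hfree horb hdeg using fun i =>
    (hN.isStepNilspace_quotient (i + 1)).exists_structureGroup
  have hproj : ∀ i, Function.Surjective (hN.factorProj i) := by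
    rintro i ⟨x⟩
    exact ⟨Quotient.mk _ x, rfl⟩
  -- Uniqueness of completions of `(k+1)`-corners makes `∼_k` equality.
  have htop : Function.Bijective (Quotient.mk (hN.simSetoid k)) := by
    refine ⟨fun x y h => ?_, Quotient.mk_surjective⟩
    have := hC.eq_top ((hN.mk_eq_iff k x y).1 h) (cubeOn_const x) fun c hc => spike_of_ne hc _ _
    rw [← this, spike_top]
  let E : KFoldBundle.{u, u, u} k X :=
    { factor := fun i => Quotient (hN.simSetoid i.val)
      grp := fun i => Z i.val
      addCommGroup := fun i => hZ i.val
      addAction := fun i => hact i.val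
      proj := fun i => hN.factorProj i.val
      isBundle := fun i => @isAbelianBundle_of _ (hZ i.val) _ _ (hact i.val) _ (hproj i.val) (hfree i.val) fun a b =>
        (hN.factorProj_eq_iff i.val a b).trans (horb i.val a b)
      -- By ergodicity `∼_0` relates any two points.
      base := by
        refine ⟨Quotient.mk _ (Classical.arbitrary X), ?_⟩
        rintro ⟨x⟩
        refine (hN.mk_eq_iff 0 _ _).2 (cubeOn_iff.2 ?_)
        rw [hN.ergodic]
        trivial
      top := Equiv.ofBijective _ htop }
  have hE : ∀ i, E.toFactor i = Quotient.mk (hN.simSetoid i.val) :=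
    E.toFactor_eq_of (fun i => Quotient.mk (hN.simSetoid i.val)) (fun _ => rfl) fun _ _ => rfl
  have hcubes : ∀ (i : Fin (k + 1)) (n : ℕ) (q : DCube n → E.factor i),
      q ∈ (E.factorCubespace C i).cubes n ↔ q ∈ (C.quotient (hN.simSetoid i.val)).cubes n := by
    intro i n q
    unfold KFoldBundle.factorCubespace quotient image
    simp only [hE i]
    rfl
  refine ⟨E, E.isDegreeBundle_of fun i n q hq d => ?_⟩
  rw [hcubes]
  exact hdeg i.val n q ((hcubes i.succ n q).1 hq) d

end Cubespace
end Nilspace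

theorem theorem3p2p13 {X : Type u} [Nonempty X] (C : Nilspace.Cubespace X) (k : ℕ) :
    (C.IsStepNilspace k ↔
      ∃ E : Nilspace.KFoldBundle.{u, u, u} k X, E.IsDegreeBundle C) ∧
    ∀ E : Nilspace.KFoldBundle.{u, v, w} k X, E.IsDegreeBundle C →
      C.IsStepNilspace k ∧
      ∀ i : Fin k, ∃ (h : Equivalence (C.sim (i.val + 1)))
        (φ : Quotient (Setoid.mk (C.sim (i.val + 1)) h) ≃ E.factor i.succ),
        (∀ x : X, φ (Quotient.mk _ x) = E.toFactor i.succ x) ∧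
        (C.quotient (Setoid.mk (C.sim (i.val + 1)) h)).IsIso (E.factorCubespace C i.succ) φ :=
  ⟨⟨fun hC => hC.exists_isDegreeBundle, fun ⟨_, hE⟩ => hE.isStepNilspace⟩,
    fun _ hE => ⟨hE.isStepNilspace, fun i => hE.exists_iso i.succ⟩⟩
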